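/- Fix a time horizon $T>0$. A moving point set consists of finitely many (say $n$) points $P(t)=(p_1(t),\dots,p_n(t))$ in the plane, each $p_i\colon[0,T]\to\mathbb{R}^2$ continuous, such that at no time all points are at the same position. An orientation is an element $\alpha$ of the real projective line (an angle modulo $\pi$), identified with a unit vector up to sign, and $\alpha^\perp$ is the orthogonal orientation. Write $w_\alpha(P)=\max_{p,q\in P}(p-q)\cdot\alpha$ for the extent of $P$ along $\alpha$. The shape descriptors are the minimizers $\alpha$ of the following cost functions: - principal component: $f_{\mathrm{PC}}(\alpha,P)=\min_{L}\sum_{p\in P}d(L,p)^2$, over all lines $L$ with orientation $\alpha$; - oriented bounding box: $f_{\mathrm{OBB}}(\alpha,P)=w_\alpha(P)\,w_{\alpha^\perp}(P)$; - thinnest covering strip: $f_{\mathrm{STRIP}}(\alpha,P)=w_{\alpha^\perp}(P)$. A state-aware algorithm $\mathcal{A}$ maintains a state over time: the state at time $0$ is determined by the input at time $0$, and the state at time $t$ is determined by the state at any earlier time $s$ and the input during $[s,t]$. It outputs at each time $t$ an orientation $\mathcal{A}(P)(t)$, computed from $P(t)$ and the state at time $t$; in particular it does not know the future. The topological stability ratio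 of a shape descriptor $\Pi$ is $$\rho_{TS}(\Pi)=\inf_{\mathcal{A}}\ \sup_{P}\ \sup_{t\in[0,T]}\ \frac{f_\Pi(\mathcal{A}(P)(t),P(t))}{\min_\gamma f_\Pi(\gamma,P(t))}\in[0,\infty],$$ where the supremum is over all moving point sets $P$ (with any number of points) and the infimum is over all state-aware algorithms $\mathcal{A}$ such that $t\mapsto\mathcal{A}(P)(t)$ is continuous for every moving point set $P$; here $0/0$ is read as $1$ and $x/0$ as $\infty$ for $x>0$. **Theorem.** For every $T>0$, $$\rho_{TS}(\mathrm{PC})=1,\qquad \rho_{TS}(\mathrm{OBB})=\tfrac54,\qquad \rho_{TS}(\mathrm{STRIP})=\sqrt2 .$$ The same values are obtained when only moving sets of exactly $n$ points are considered, for every fixed $n\ge2$ (PC), $n\ge5$ (OBB), and $n\ge4$ (STRIP). -/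

import Mathlib

open Set
open scoped ENNReal

noncomputable section

namespace ShapeStability

/-- The Euclidean plane. -/
abbrev Plane : Type := EuclideanSpace ℝ (Fin 2)

/-- Orientations: the real projective line, represented as angles modulo `π`, with its quotient
topology (a topological circle). -/
abbrev Orientation : Type := AddCircle Real.pi

/-- The unit vector at angle `θ`. -/
def unitVec (θ : ℝ) : Plane := !₂[Real.cos θ, Real.sin θ]

theorem unitVec_add_pi (θ : ℝ) : unitVec (θ + Real.pi) = -unitVec θ := by
  ext i
  fin_cases i <;> simp [unitVec, Real.cos_add_pi, Real.sin_add_pi]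

/-- The extent of the point set along the vector `v`: `max_{p, q} (p - q) · v`. -/
def extent {n : ℕ} (v : Plane) (P : Fin n → Plane) : ℝ :=
  ⨆ pq : Fin n × Fin n, inner ℝ (P pq.1 - P pq.2) v

theorem extent_neg {n : ℕ} (v : Plane) (P : Fin n → Plane) : extent (-v) P = extent v P := by
  refine (Equiv.prodComm (Fin n) (Fin n)).iSup_congr fun pq => ?_
  rw [inner_neg_right, ← inner_neg_left, neg_sub]
  rfl

/-- The lines in the plane that are parallel to the (unit) vector `v`. -/
def linesAlong (v : Plane) : Set (AffineSubspace ℝ Plane) :=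
  {L | (L : Set Plane).Nonempty ∧ L.direction = Submodule.span ℝ {v}}

/-- The least sum of squared distances from the points to a line parallel to `v`. -/
def minSqDist {n : ℕ} (v : Plane) (P : Fin n → Plane) : ℝ :=
  ⨅ L : linesAlong v, ∑ i, Metric.infDist (P i) ((L : AffineSubspace ℝ Plane) : Set Plane) ^ 2

theorem minSqDist_neg {n : ℕ} (v : Plane) (P : Fin n → Plane) :
    minSqDist (-v) P = minSqDist v P := by
  have h : linesAlong (-v) = linesAlong v := by
    have hs : Submodule.span ℝ {-v} = Submodule.span ℝ {v} := by
      rw [← Set.neg_singleton, Submodule.span_neg]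
    simp only [linesAlong, hs]
  unfold minSqDist
  rw [h]

/-- A shape descriptor, given by its cost function: the cost of an orientation for a family of
`n` points (for every `n`). The optimal orientations are the minimizers of the cost. -/
abbrev ShapeDescriptor : Type := ∀ n : ℕ, Orientation → (Fin n → Plane) → ℝ

theorem pc_periodic {n : ℕ} (P : Fin n → Plane) :
    Function.Periodic (fun θ : ℝ => minSqDist (unitVec θ) P) Real.pi := by
  intro θ
  simp only [unitVec_add_pi, minSqDist_neg]

/-- Principal component: the least sum of squared distances to a line of the orientation. -/
def PC : ShapeDescriptor := fun _ α P => (pc_periodic P).lift α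

theorem obb_periodic {n : ℕ} (P : Fin n → Plane) :
    Function.Periodic
      (fun θ : ℝ => extent (unitVec θ) P * extent (unitVec (θ + Real.pi / 2)) P) Real.pi := by
  intro θ
  have h : θ + Real.pi + Real.pi / 2 = (θ + Real.pi / 2) + Real.pi := by ring
  simp only [h, unitVec_add_pi, extent_neg]

/-- Oriented bounding box: the area of the bounding box of the orientation. -/
def OBB : ShapeDescriptor := fun _ α P => (obb_periodic P).lift α

theorem strip_periodic {n : ℕ} (P : Fin n → Plane) :
    Function.Periodic (fun θ : ℝ => extent (unitVec (θ + Real.pi / 2)) P) Real.pi := by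
  intro θ
  have h : θ + Real.pi + Real.pi / 2 = (θ + Real.pi / 2) + Real.pi := by ring
  simp only [h, unitVec_add_pi, extent_neg]

/-- Covering strip: the width of the thinnest covering strip of the orientation. -/
def STRIP : ShapeDescriptor := fun _ α P => (strip_periodic P).lift α

/-- `n` points moving continuously in the plane during `[0, T]`, never all at one position. -/
structure MovingPoints (n : ℕ) (T : ℝ) where
  /-- the positions at a given time -/
  pos : Icc (0 : ℝ) T → Fin n → Plane
  continuous_pos : ∀ i, Continuous fun t => pos t i
  not_all_equal : ∀ t, ∃ i j, pos t i ≠ pos t j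

/-- A state-aware algorithm for `n` points moving during `[0, T]`. It maintains a state: the
initial state is determined by the input at time `0`, and the state at a time `t` is determined
by the state at any earlier time `s` and the input during `[s, t]` (so it does not depend on
the future). The output at time `t` is computed from the input and the state at time `t`. -/
structure StateAwareAlgorithm (n : ℕ) (T : ℝ) where
  /-- the type of states -/
  State : Type
  /-- the state maintained for a moving point set, at a given time -/
  state : MovingPoints n T → Icc (0 : ℝ) T → State
  state_init : ∀ (P Q : MovingPoints n T) (t : Icc (0 : ℝ) T), (t : ℝ) = 0 →
    P.pos t = Q.pos t → state P t = state Q t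
  state_step : ∀ (P Q : MovingPoints n T) (s t : Icc (0 : ℝ) T), s ≤ t →
    state P s = state Q s → (∀ u, s ≤ u → u ≤ t → P.pos u = Q.pos u) → state P t = state Q t
  /-- the orientation computed from the current input and the current state -/
  compute : (Fin n → Plane) → State → Orientation

/-- The output of the algorithm on a moving point set, as a function of time. -/
def StateAwareAlgorithm.output {n : ℕ} {T : ℝ} (A : StateAwareAlgorithm n T)
    (P : MovingPoints n T) (t : Icc (0 : ℝ) T) : Orientation :=
  A.compute (P.pos t) (A.state P t)

/-- The output moves continuously on every continuously moving point set. -/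
def StateAwareAlgorithm.IsContinuous {n : ℕ} {T : ℝ} (A : StateAwareAlgorithm n T) : Prop :=
  ∀ P : MovingPoints n T, Continuous (A.output P)

/-- The ratio of a cost to the optimal cost, where an optimal cost of `0` gives ratio `1` to
the cost `0` and ratio `∞` to positive costs. -/
def costRatio (cost opt : ℝ) : ℝ≥0∞ :=
  if opt = 0 ∧ cost = 0 then 1 else ENNReal.ofReal cost / ENNReal.ofReal opt

/-- The approximation ratio of the orientation `α` for the points `P`. -/
def approxRatio (D : ShapeDescriptor) {n : ℕ} (α : Orientation) (P : Fin n → Plane) : ℝ≥0∞ :=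
  costRatio (D n α P) (⨅ γ : Orientation, D n γ P)

/-- The worst approximation ratio of an algorithm for `n` points, over all moving point sets and
all times. -/
def worstRatio (D : ShapeDescriptor) {n : ℕ} {T : ℝ} (A : StateAwareAlgorithm n T) : ℝ≥0∞ :=
  ⨆ (P : MovingPoints n T) (t : Icc (0 : ℝ) T), approxRatio D (A.output P t) (P.pos t)

/-- The topological stability ratio, for moving sets of exactly `n` points. -/
def topStabilityRatioOf (D : ShapeDescriptor) (n : ℕ) (T : ℝ) : ℝ≥0∞ :=
  ⨅ (A : StateAwareAlgorithm n T) (_ : A.IsContinuous), worstRatio D A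

/-- The topological stability ratio, for moving point sets with any (finite, constant over time)
number of points: an algorithm now handles every number of points. -/
def topStabilityRatio (D : ShapeDescriptor) (T : ℝ) : ℝ≥0∞ :=
  ⨅ (A : ∀ n : ℕ, StateAwareAlgorithm n T) (_ : ∀ n, (A n).IsContinuous),
    ⨆ n : ℕ, worstRatio D (A n)

end ShapeStability

end

/-!
**Upper bounds.** Each cost is a function on a circle: of length `π` for principal components and
strips, and of length `π / 2` for bounding boxes, since orthogonal orientations have the same box.
The geometric input is the notion `IsConnectedCost`: of the two arcs between two near-optimal
points, one has cost at most about `ρ` times the minimum. For principal components (`ρ = 1`) the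
cost is a quadratic form of the direction, so its sublevel sets are arcs. For strips (`ρ = √2`) the
extent is a seminorm of the direction, and the shorter arc spans at most a right angle. For boxes
(`ρ = 5 / 4`) the extents of the two boxes also bound each other; this excludes that both arcs are
bad (`sum_le_or_sum_le`, `box_connected`).

It follows that, where some orientation is bad (costs more than `ρ` times the minimum), all bad
orientations lie in the same gap between near-optimal ones. Cutting the circle at a bad orientation
and averaging the near-optimal ones gives a direction of low cost that does not depend on the cut
and that varies continuously with the configuration (`meanDirection`), also at collinear
configurations, where the optimum is unique and has cost `0`. Where no orientation is bad, the output
is unconstrained. An algorithm thus has to follow a direction that is defined on a part of the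
configuration space. No continuous function of the configuration can do so, as the direction may
have wound around the circle, but the past of the path determines a continuous lift of the direction
to the reals along the current excursion into that part, and the output is this lift, faded out
towards `0` where all orientations are good (`exists_causal_tracking`,
`IsConnectedCost.exists_causal_approx`).

**Lower bounds.** A single path suffices for each descriptor. It begins and ends with collinear
points, where only the optima have finite ratio, and a set of orientations of ratio at least `ρ`
separates the optima at the beginning from those at the end at all times. By the intermediate value
theorem the output crosses this set (`le_worstRatio_of_barrier`). For strips, a horizontal segment
turns into a vertical one through rectangles; for boxes, a segment opens up to a rhombus with
diagonals of ratio `2`, parallel to one pair of its sides, and closes again parallel to the other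
pair.
-/

noncomputable section

namespace ShapeStability

open Filter Topology

/-! ### Causal tracking of a circle-valued direction -/

/-- `g` lifts the circle-valued path `ψ` to the reals along the current excursion of `ℓ` above
`0`: the excursion begins at time `s` (at time `0`, or when `ℓ` leaves the value `0`) and is still
going on at time `t`, and the lift starts in the fundamental interval `[0, p)`. -/
structure IsExcursionLift {p : ℝ} (ℓ : ℝ → ℝ) (ψ : ℝ → AddCircle p) (s t : ℝ) (g : ℝ → ℝ) :
    Prop where
  nonneg : 0 ≤ s
  le : s ≤ t
  continuousOn : ContinuousOn g (Icc s t)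
  lifts : ∀ u ∈ Icc s t, (g u : AddCircle p) = ψ u
  start_mem : g s ∈ Ico 0 p
  pos : ∀ u ∈ Ioc s t, 0 < ℓ u
  start : s = 0 ∨ ℓ s ≤ 0

theorem IsExcursionLift.restrict {p : ℝ} {ℓ : ℝ → ℝ} {ψ : ℝ → AddCircle p} {s t u : ℝ} {g : ℝ → ℝ}
    (h : IsExcursionLift ℓ ψ s t g) (hu : u ∈ Icc s t) : IsExcursionLift ℓ ψ s u g where
  nonneg := h.nonneg
  le := hu.1
  continuousOn := h.continuousOn.mono (Icc_subset_Icc_right hu.2)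
  lifts v hv := h.lifts v ⟨hv.1, hv.2.trans hu.2⟩
  start_mem := h.start_mem
  pos v hv := h.pos v ⟨hv.1, hv.2.trans hu.2⟩
  start := h.start

theorem IsExcursionLift.congr {p : ℝ} {ℓ ℓ' : ℝ → ℝ} {ψ ψ' : ℝ → AddCircle p} {s t : ℝ}
    {g : ℝ → ℝ} (h : IsExcursionLift ℓ ψ s t g) (hℓ : ∀ u ∈ Icc 0 t, ℓ u = ℓ' u)
    (hψ : ∀ u ∈ Icc 0 t, ψ u = ψ' u) : IsExcursionLift ℓ' ψ' s t g where
  nonneg := h.nonneg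
  le := h.le
  continuousOn := h.continuousOn
  lifts v hv := (h.lifts v hv).trans (hψ v ⟨h.nonneg.trans hv.1, hv.2⟩)
  start_mem := h.start_mem
  pos v hv := by rw [← hℓ v ⟨h.nonneg.trans hv.1.le, hv.2⟩]; exact h.pos v hv
  start := by rw [← hℓ s ⟨h.nonneg, h.le⟩]; exact h.start

/-- The lift at time `t` is determined by the path up to time `t`. -/
theorem IsExcursionLift.unique {p : ℝ} [hp : Fact (0 < p)] {ℓ : ℝ → ℝ} {ψ : ℝ → AddCircle p}
    {s s' t : ℝ} {g g' : ℝ → ℝ} (h : IsExcursionLift ℓ ψ s t g)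
    (h' : IsExcursionLift ℓ ψ s' t g') : g t = g' t := by
  have key : ∀ {s s' : ℝ} {g g' : ℝ → ℝ}, IsExcursionLift ℓ ψ s t g →
      IsExcursionLift ℓ ψ s' t g' → s' ≤ s := by
    intro s s' g g' h h'
    by_contra hlt
    push Not at hlt
    have h1 := h.pos s' ⟨hlt, h'.le⟩
    rcases h'.start with h2 | h2
    · linarith [h.nonneg]
    · linarith
  obtain rfl : s = s' := le_antisymm (key h' h) (key h h')
  have hs : g s = g' s := by
    have h1 := (h.lifts s ⟨le_rfl, h.le⟩).trans (h'.lifts s ⟨le_rfl, h.le⟩).symm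
    have h2 := h.start_mem
    have h3 := h'.start_mem
    rw [show Ico 0 p = Ico 0 (0 + p) by rw [zero_add]] at h2 h3
    exact (AddCircle.coe_eq_coe_iff_of_mem_Ico (a := 0) h2 h3).1 h1
  have hc : IsCoveringMap ((↑) : ℝ → AddCircle p) := AddCircle.isCoveringMap_coe p
  exact hc.eqOn_of_comp_eqOn isPreconnected_Icc h.continuousOn h'.continuousOn
    (fun u hu => (h.lifts u hu).trans (h'.lifts u hu).symm) ⟨le_rfl, h.le⟩ hs ⟨h.le, le_rfl⟩

theorem exists_lift_Icc {p : ℝ} [hp : Fact (0 < p)] {ψ : ℝ → AddCircle p} {s t : ℝ} (hst : s ≤ t)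
    (hψ : ContinuousOn ψ (Icc s t)) :
    ∃ g : ℝ → ℝ, ContinuousOn g (Icc s t) ∧ (∀ u ∈ Icc s t, (g u : AddCircle p) = ψ u) ∧
      g s ∈ Ico 0 p := by
  have hc : IsCoveringMap ((↑) : ℝ → AddCircle p) := AddCircle.isCoveringMap_coe p
  obtain ⟨e, he, hes⟩ : ∃ e ∈ Ico (0 : ℝ) p, (e : AddCircle p) = ψ s := by
    have := AddCircle.coe_image_Ico_eq p 0
    have h2 : ψ s ∈ ((↑) : ℝ → AddCircle p) '' Ico 0 (0 + p) := by rw [this]; trivial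
    obtain ⟨e, he, h⟩ := h2
    exact ⟨e, by simpa using he, h⟩
  rcases hst.eq_or_lt with rfl | hlt
  · refine ⟨fun _ => e, continuousOn_const, fun u hu => ?_, he⟩
    obtain rfl : u = s := le_antisymm hu.2 hu.1
    exact hes
  have hpos : 0 < t - s := sub_pos.2 hlt
  have hmem : ∀ r : unitInterval, s + r * (t - s) ∈ Icc s t := fun r =>
    ⟨by nlinarith [r.2.1], by nlinarith [r.2.2]⟩
  let γ : C(unitInterval, AddCircle p) :=
    ⟨fun r => ψ (s + r * (t - s)), hψ.comp_continuous (by fun_prop) hmem⟩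
  have hγ0 : γ 0 = (e : AddCircle p) := by simp [γ, hes]
  obtain ⟨Γ, hΓ, hΓ0⟩ := hc.exists_path_lifts γ e hγ0
  refine ⟨fun u => Γ (projIcc 0 1 zero_le_one ((u - s) / (t - s))), ?_, fun u hu => ?_, ?_⟩
  · exact (Γ.continuous.comp (continuous_projIcc.comp (by fun_prop))).continuousOn
  · have h1 : (u - s) / (t - s) ∈ Icc (0 : ℝ) 1 :=
      ⟨div_nonneg (sub_nonneg.2 hu.1) hpos.le, (div_le_one hpos).2 (by linarith [hu.2])⟩
    have h2 := congrFun hΓ (projIcc 0 1 zero_le_one ((u - s) / (t - s)))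
    simp only [Function.comp_apply] at h2
    rw [h2]
    simp only [γ, ContinuousMap.coe_mk, projIcc_of_mem zero_le_one h1]
    congr 1
    field_simp
    ring
  · have : projIcc (0 : ℝ) 1 zero_le_one ((s - s) / (t - s)) = 0 := by
      simp
    simp only [this, hΓ0]
    exact he

/-- If `ℓ` is positive on `[t, t']`, then the current excursion reaches back from `t'` to some time
before `t`, and `ψ` lifts along it. -/
theorem exists_isExcursionLift {p : ℝ} [hp : Fact (0 < p)] {ℓ : ℝ → ℝ} {ψ : ℝ → AddCircle p}
    (hℓ : Continuous ℓ) (hψ : ContinuousOn ψ {u | 0 ≤ ℓ u}) {t t' : ℝ} (ht : 0 ≤ t) (htt' : t ≤ t')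
    (hpos : ∀ u ∈ Icc t t', 0 < ℓ u) :
    ∃ s g, s ≤ t ∧ IsExcursionLift ℓ ψ s t' g := by
  obtain ⟨s, hs0, hst, hs1, hs2⟩ : ∃ s, 0 ≤ s ∧ s ≤ t ∧ (∀ u ∈ Ioc s t, 0 < ℓ u) ∧
      (s = 0 ∨ ℓ s ≤ 0) := by
    by_cases hne : (Icc 0 t ∩ {u | ℓ u ≤ 0}).Nonempty
    · have hcl : IsCompact (Icc 0 t ∩ {u | ℓ u ≤ 0}) :=
        isCompact_Icc.inter_right (isClosed_le hℓ continuous_const)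
      have hmem := hcl.sSup_mem hne
      refine ⟨_, hmem.1.1, hmem.1.2, fun u hu => ?_, Or.inr hmem.2⟩
      by_contra hle
      have := le_csSup hcl.bddAbove (a := u) ⟨⟨hmem.1.1.trans hu.1.le, hu.2⟩, not_lt.1 hle⟩
      exact absurd hu.1 (not_lt.2 this)
    · refine ⟨0, le_rfl, ht, fun u hu => ?_, Or.inl rfl⟩
      by_contra hle
      exact hne ⟨u, ⟨hu.1.le, hu.2⟩, not_lt.1 hle⟩
  have hpos' : ∀ u ∈ Ioc s t', 0 < ℓ u := fun u hu => by
    rcases le_total u t with h | h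
    · exact hs1 u ⟨hu.1, h⟩
    · exact hpos u ⟨h, hu.2⟩
  have hnonneg : ∀ u ∈ Icc s t', 0 ≤ ℓ u := fun u hu => by
    rcases hu.1.eq_or_lt with rfl | h
    · rcases hst.eq_or_lt with rfl | hlt
      · exact (hpos s ⟨le_rfl, htt'⟩).le
      · have hsub : Icc s t ⊆ {u | 0 ≤ ℓ u} := by
          rw [← closure_Ioc hlt.ne]
          exact closure_minimal (fun v hv => (hs1 v hv).le) (isClosed_le continuous_const hℓ)
        exact hsub ⟨le_rfl, hst⟩
    · exact (hpos' u ⟨h, hu.2⟩).le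
  obtain ⟨g, hg, hlift, hstart⟩ := exists_lift_Icc (hst.trans htt') (hψ.mono hnonneg)
  exact ⟨s, g, hst, ⟨hs0, hst.trans htt', hg, hlift, hstart, hpos', hs2⟩⟩

/-- The value at time `t` of the lift of `ψ` along the current excursion of `ℓ` above `0`
(an arbitrary number if there is no such excursion). -/
def excursionAngle {p : ℝ} (ℓ : ℝ → ℝ) (ψ : ℝ → AddCircle p) (t : ℝ) : ℝ :=
  Classical.epsilon fun y => ∃ s g, IsExcursionLift ℓ ψ s t g ∧ y = g t

theorem excursionAngle_eq {p : ℝ} [hp : Fact (0 < p)] {ℓ : ℝ → ℝ} {ψ : ℝ → AddCircle p}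
    {s t : ℝ} {g : ℝ → ℝ} (h : IsExcursionLift ℓ ψ s t g) :
    excursionAngle ℓ ψ t = g t := by
  have hex : ∃ y, ∃ s g, IsExcursionLift ℓ ψ s t g ∧ y = g t := ⟨g t, s, g, h, rfl⟩
  obtain ⟨s', g', h', heq⟩ := Classical.epsilon_spec hex
  rw [excursionAngle, heq]
  exact h'.unique h

theorem excursionAngle_congr {p : ℝ} {ℓ ℓ' : ℝ → ℝ} {ψ ψ' : ℝ → AddCircle p} {t : ℝ}
    (hℓ : ∀ u ∈ Icc 0 t, ℓ u = ℓ' u) (hψ : ∀ u ∈ Icc 0 t, ψ u = ψ' u) :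
    excursionAngle ℓ ψ t = excursionAngle ℓ' ψ' t := by
  unfold excursionAngle
  congr 1
  ext y
  constructor
  · rintro ⟨s, g, h, rfl⟩
    exact ⟨s, g, h.congr hℓ hψ, rfl⟩
  · rintro ⟨s, g, h, rfl⟩
    exact ⟨s, g, h.congr (fun u hu => (hℓ u hu).symm) (fun u hu => (hψ u hu).symm), rfl⟩

theorem coe_excursionAngle {p : ℝ} [hp : Fact (0 < p)] {ℓ : ℝ → ℝ} {ψ : ℝ → AddCircle p}
    (hℓ : Continuous ℓ) (hψ : ContinuousOn ψ {u | 0 ≤ ℓ u}) {t : ℝ} (ht : 0 ≤ t)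
    (hpos : 0 < ℓ t) : (excursionAngle ℓ ψ t : AddCircle p) = ψ t := by
  obtain ⟨s, g, hst, h⟩ := exists_isExcursionLift hℓ hψ ht le_rfl
    (fun u hu => by obtain rfl : u = t := le_antisymm hu.2 hu.1; exact hpos)
  rw [excursionAngle_eq h]
  exact h.lifts t ⟨h.le, le_rfl⟩

theorem continuousWithinAt_excursionAngle {p : ℝ} [hp : Fact (0 < p)] {ℓ : ℝ → ℝ}
    {ψ : ℝ → AddCircle p} (hℓ : Continuous ℓ) (hψ : ContinuousOn ψ {u | 0 ≤ ℓ u}) {t : ℝ}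
    (ht : 0 ≤ t) (hpos : 0 < ℓ t) :
    ContinuousWithinAt (excursionAngle ℓ ψ) (Ici 0) t := by
  have hev : ∀ᶠ u in 𝓝 t, 0 < ℓ u := hℓ.continuousAt.eventually_const_lt hpos
  obtain ⟨ε, hε, hball⟩ := Metric.eventually_nhds_iff.1 hev
  obtain ⟨s, g, hst, h⟩ := exists_isExcursionLift hℓ hψ ht (by linarith : t ≤ t + ε / 2)
    (fun u hu => hball (by
      rw [Real.dist_eq, abs_of_nonneg (by linarith [hu.1])]; linarith [hu.2]))
  have hnhds : Icc s (t + ε / 2) ∈ 𝓝[Ici 0] t := by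
    rcases hst.eq_or_lt with rfl | hlt
    · rcases h.start with h0 | h0
      · subst h0
        exact Icc_mem_nhdsGE (by linarith)
      · exact absurd hpos (not_lt.2 h0)
    · exact mem_nhdsWithin_of_mem_nhds (Icc_mem_nhds hlt (by linarith))
  have hg : ContinuousWithinAt g (Ici 0) t :=
    (h.continuousOn t ⟨hst, by linarith⟩).mono_of_mem_nhdsWithin hnhds
  refine hg.congr_of_eventuallyEq ?_ (excursionAngle_eq (h.restrict ⟨hst, by linarith⟩))
  filter_upwards [hnhds] with u hu
  exact excursionAngle_eq (h.restrict hu)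

/-- The product `l * φ`, damped so that it tends to `0` as `l → 0` however large `φ` is. -/
def damp (l φ : ℝ) : ℝ := l * φ / (1 + (1 - l) * |φ|)

theorem damp_denom_pos {l : ℝ} (h1 : l ≤ 1) (φ : ℝ) : 0 < 1 + (1 - l) * |φ| := by
  linarith [mul_nonneg (sub_nonneg.2 h1) (abs_nonneg φ)]

theorem abs_damp_le {l : ℝ} (h0 : 0 ≤ l) (h1 : l < 1) (φ : ℝ) : |damp l φ| ≤ l / (1 - l) := by
  have hd := damp_denom_pos h1.le φ
  rw [damp, abs_div, abs_of_pos hd, abs_mul, abs_of_nonneg h0,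
    div_le_div_iff₀ hd (sub_pos.2 h1)]
  nlinarith [abs_nonneg φ, mul_nonneg h0 (sub_nonneg.2 h1.le), mul_nonneg h0 h0]

/-- Causal tracking of a partially defined circle-valued direction: a continuous causal real-valued
output that agrees modulo `p` with `dir` as long as `1 ≤ lam`. -/
theorem exists_causal_tracking {X : Type*} [TopologicalSpace X] {p : ℝ} [hp : Fact (0 < p)]
    {lam : X → ℝ} (hlam : Continuous lam) {dir : X → AddCircle p}
    (hdir : ContinuousOn dir {x | 0 ≤ lam x}) :
    ∃ out : (ℝ → X) → ℝ → ℝ,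
      (∀ c, Continuous c → ContinuousOn (out c) (Ici 0)) ∧
      (∀ c c' t, (∀ u ∈ Icc 0 t, c u = c' u) → 0 ≤ t → out c t = out c' t) ∧
      (∀ c t, Continuous c → 0 ≤ t → 1 ≤ lam (c t) → (out c t : AddCircle p) = dir (c t)) := by
  refine ⟨fun c t => damp (min 1 (max 0 (lam (c t))))
    (excursionAngle (fun u => lam (c u)) (fun u => dir (c u)) t), fun c hc t ht => ?_,
    fun c c' t h ht => ?_, fun c t hc ht h1 => ?_⟩
  · have hℓ : Continuous fun u => lam (c u) := hlam.comp hc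
    have hψ : ContinuousOn (fun u => dir (c u)) {u | 0 ≤ lam (c u)} :=
      hdir.comp hc.continuousOn fun u hu => hu
    have hl : Continuous fun u => min 1 (max 0 (lam (c u))) := by fun_prop
    have hl0 : ∀ u, 0 ≤ min 1 (max 0 (lam (c u))) := fun u => by positivity
    have hl1 : ∀ u, min 1 (max 0 (lam (c u))) ≤ 1 := fun u => min_le_left _ _
    rcases lt_or_ge 0 (lam (c t)) with hpos | hneg
    · have hφ := continuousWithinAt_excursionAngle hℓ hψ ht hpos
      have hlw : ContinuousWithinAt (fun u => min 1 (max 0 (lam (c u)))) (Ici 0) t :=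
        hl.continuousWithinAt
      exact (hlw.mul hφ).div (continuousWithinAt_const.add
        ((continuousWithinAt_const.sub hlw).mul hφ.abs)) (damp_denom_pos (hl1 t) _).ne'
    · have hlt : min 1 (max 0 (lam (c t))) = 0 := by
        rw [max_eq_left hneg, min_eq_right zero_le_one]
      have hlim : Tendsto (fun u => min 1 (max 0 (lam (c u))) / (1 - min 1 (max 0 (lam (c u)))))
          (𝓝 t) (𝓝 0) := by
        have h : ContinuousAt
            (fun u => min 1 (max 0 (lam (c u))) / (1 - min 1 (max 0 (lam (c u))))) t :=
          hl.continuousAt.div (continuousAt_const.sub hl.continuousAt) (by rw [hlt]; norm_num)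
        have h' := h.tendsto
        rwa [hlt, zero_div] at h'
      have hev : ∀ᶠ u in 𝓝 t, min 1 (max 0 (lam (c u))) < 1 :=
        hl.continuousAt.eventually_lt_const (by simp only [hlt]; exact zero_lt_one)
      have hres : Tendsto (fun u => damp (min 1 (max 0 (lam (c u))))
          (excursionAngle (fun u => lam (c u)) (fun u => dir (c u)) u)) (𝓝 t) (𝓝 0) := by
        refine squeeze_zero_norm' ?_ hlim
        filter_upwards [hev] with u hu
        exact abs_damp_le (hl0 u) hu _
      have h0 : damp (min 1 (max 0 (lam (c t))))
          (excursionAngle (fun u => lam (c u)) (fun u => dir (c u)) t) = 0 := by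
        simp [damp, hlt]
      refine ContinuousAt.continuousWithinAt ?_
      simp only [ContinuousAt, h0]
      exact hres
  · simp only
    rw [h t ⟨ht, le_rfl⟩, excursionAngle_congr (fun u hu => by rw [h u hu])
      (fun u hu => by rw [h u hu])]
  · have hℓ : Continuous fun u => lam (c u) := hlam.comp hc
    have hψ : ContinuousOn (fun u => dir (c u)) {u | 0 ≤ lam (c u)} :=
      hdir.comp hc.continuousOn fun u hu => hu
    have hlt : min 1 (max 0 (lam (c t))) = 1 := min_eq_left (le_max_of_le_right h1)
    simp only [hlt, damp]
    norm_num
    exact coe_excursionAngle hℓ hψ ht (by linarith)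

/-! ### Costs on a circle and the mean of the near-minimizers -/

/-- The mean, with respect to the periodic weight `w`, of the real line cut to the period
`[a, a + p]`. -/
def cutMean (w : ℝ → ℝ) (p a : ℝ) : ℝ :=
  (∫ θ in a..a + p, θ * w θ) / ∫ θ in a..a + p, w θ

section CutMean

variable {w : ℝ → ℝ} {p a a' : ℝ}

theorem integral_sub_cutMean_mul (hw : Continuous w) (hW : 0 < ∫ θ in a..a + p, w θ) :
    ∫ θ in a..a + p, (θ - cutMean w p a) * w θ = 0 := by
  have h1 : IntervalIntegrable (fun θ => θ * w θ) MeasureTheory.volume a (a + p) :=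
    (continuous_id.mul hw).intervalIntegrable _ _
  have h2 : IntervalIntegrable (fun θ => cutMean w p a * w θ) MeasureTheory.volume a (a + p) :=
    (continuous_const.mul hw).intervalIntegrable _ _
  simp_rw [sub_mul]
  rw [intervalIntegral.integral_sub h1 h2, intervalIntegral.integral_const_mul, cutMean,
    div_mul_cancel₀ _ hW.ne', sub_self]

theorem exists_pos_of_integral_pos (hp : 0 < p) (hW : 0 < ∫ θ in a..a + p, w θ) :
    ∃ θ ∈ Icc a (a + p), 0 < w θ := by
  by_contra! h
  have := intervalIntegral.integral_nonneg (μ := MeasureTheory.volume) (f := fun θ => -w θ)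
    (by linarith : a ≤ a + p) fun θ hθ => neg_nonneg.2 (h θ hθ)
  rw [intervalIntegral.integral_neg] at this
  linarith

theorem exists_pos_le_cutMean (hp : 0 < p) (hw : Continuous w) (h0 : ∀ θ, 0 ≤ w θ)
    (hW : 0 < ∫ θ in a..a + p, w θ) :
    ∃ θ ∈ Icc a (a + p), θ ≤ cutMean w p a ∧ 0 < w θ := by
  by_contra! h
  have hz := integral_sub_cutMean_mul hw hW
  obtain ⟨θ₀, hθ₀, hpos⟩ := exists_pos_of_integral_pos hp hW
  have hcont : Continuous fun θ => (θ - cutMean w p a) * w θ := by fun_prop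
  refine absurd hz (intervalIntegral.integral_pos (by linarith) hcont.continuousOn
    (fun θ hθ => ?_) ⟨θ₀, hθ₀, ?_⟩).ne'
  · rcases le_or_gt θ (cutMean w p a) with hle | hlt
    · rw [le_antisymm (h θ (Ioc_subset_Icc_self hθ) hle) (h0 θ), mul_zero]
    · exact mul_nonneg (sub_nonneg.2 hlt.le) (h0 θ)
  · refine mul_pos (sub_pos.2 ?_) hpos
    by_contra hle
    exact absurd hpos (not_lt.2 (h θ₀ hθ₀ (not_lt.1 hle)))

theorem exists_pos_ge_cutMean (hp : 0 < p) (hw : Continuous w) (h0 : ∀ θ, 0 ≤ w θ)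
    (hW : 0 < ∫ θ in a..a + p, w θ) :
    ∃ θ ∈ Icc a (a + p), cutMean w p a ≤ θ ∧ 0 < w θ := by
  by_contra! h
  have hz := integral_sub_cutMean_mul hw hW
  obtain ⟨θ₀, hθ₀, hpos⟩ := exists_pos_of_integral_pos hp hW
  have hcont : Continuous fun θ => -((θ - cutMean w p a) * w θ) := by fun_prop
  rw [← neg_eq_zero, ← intervalIntegral.integral_neg] at hz
  refine absurd hz (intervalIntegral.integral_pos (by linarith) hcont.continuousOn
    (fun θ hθ => ?_) ⟨θ₀, hθ₀, ?_⟩).ne'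
  · rw [← neg_mul, neg_sub]
    rcases le_or_gt (cutMean w p a) θ with hle | hlt
    · rw [le_antisymm (h θ (Ioc_subset_Icc_self hθ) hle) (h0 θ), mul_zero]
    · exact mul_nonneg (sub_nonneg.2 hlt.le) (h0 θ)
  · rw [← neg_mul, neg_sub]
    refine mul_pos (sub_pos.2 ?_) hpos
    by_contra hle
    exact absurd hpos (not_lt.2 (h θ₀ hθ₀ (not_lt.1 hle)))

/-- Moving the cut from `a` to `a'` shifts the mean by `p` times the proportion of the weight that
lies between the two cuts. -/
theorem cutMean_eq_add (hw : Continuous w) (hper : Function.Periodic w p) :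
    cutMean w p a' =
      cutMean w p a + p * (∫ θ in a..a', w θ) / ∫ θ in a..a + p, w θ := by
  have hi : ∀ b c, IntervalIntegrable (fun θ => θ * w θ) MeasureTheory.volume b c := fun b c =>
    (continuous_id.mul hw).intervalIntegrable _ _
  have hi' : ∀ b c, IntervalIntegrable w MeasureTheory.volume b c := fun b c =>
    hw.intervalIntegrable _ _
  have h1 : ∫ θ in a'..a' + p, w θ = ∫ θ in a..a + p, w θ := hper.intervalIntegral_add_eq a' a
  have h2 : ∫ θ in a + p..a' + p, θ * w θ = (∫ θ in a..a', θ * w θ) + p * ∫ θ in a..a', w θ := by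
    rw [← intervalIntegral.integral_comp_add_right (fun θ => θ * w θ) p]
    simp_rw [hper _, add_mul]
    rw [intervalIntegral.integral_add (hi _ _) ((hi' _ _).const_mul p),
      intervalIntegral.integral_const_mul]
  have h3 := intervalIntegral.integral_add_adjacent_intervals (hi a a') (hi a' (a' + p))
  have h4 := intervalIntegral.integral_add_adjacent_intervals (hi a (a + p)) (hi (a + p) (a' + p))
  rw [cutMean, cutMean, h1, ← add_div]
  congr 1
  linarith

theorem integral_eq_zero_of_eqOn_zero {b c : ℝ} (hbc : b ≤ c) (h : ∀ θ ∈ Icc b c, w θ = 0) :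
    ∫ θ in b..c, w θ = 0 := by
  rw [intervalIntegral.integral_congr (g := fun _ => 0) (by rwa [EqOn, uIcc_of_le hbc])]
  simp

/-- If one of the two arcs between the cuts carries no weight, then the means for both cuts agree
modulo `p`. -/
theorem coe_cutMean_eq (hw : Continuous w) (hper : Function.Periodic w p)
    (hW : 0 < ∫ θ in a..a + p, w θ) (h1 : a ≤ a') (h2 : a' ≤ a + p)
    (h : (∀ θ ∈ Icc a a', w θ = 0) ∨ ∀ θ ∈ Icc a' (a + p), w θ = 0) :
    (cutMean w p a' : AddCircle p) = cutMean w p a := by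
  rw [cutMean_eq_add hw hper]
  rcases h with h | h
  · rw [integral_eq_zero_of_eqOn_zero h1 h]
    simp
  · have h3 := intervalIntegral.integral_add_adjacent_intervals
      (hw.intervalIntegrable (μ := MeasureTheory.volume) a a')
      (hw.intervalIntegrable (μ := MeasureTheory.volume) a' (a + p))
    rw [integral_eq_zero_of_eqOn_zero h2 h, add_zero] at h3
    rw [h3, mul_div_cancel_right₀ _ hW.ne']
    simp

end CutMean

/-- A family of nonnegative costs on the circle of length `p`, depending continuously on a
parameter, in which a cost vanishes at no more than one point, and whose near-minimizers are
connected at low cost: of the two arcs between two points of cost at most `κ` times the minimum,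
one has cost at most `ρ` times the minimum. -/
structure IsConnectedCost {X : Type*} [TopologicalSpace X] {p : ℝ} (F : X → AddCircle p → ℝ)
    (κ ρ : ℝ) : Prop where
  continuous : Continuous fun q : X × AddCircle p => F q.1 q.2
  nonneg : ∀ x γ, 0 ≤ F x γ
  unique_zero : ∀ x γ γ', F x γ = 0 → F x γ' = 0 → γ = γ'
  connected : ∀ x (θ₁ θ₂ : ℝ), 0 < (⨅ γ, F x γ) → θ₁ ≤ θ₂ → θ₂ ≤ θ₁ + p →
    F x θ₁ ≤ κ * (⨅ γ, F x γ) → F x θ₂ ≤ κ * (⨅ γ, F x γ) →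
    (∀ θ ∈ Icc θ₁ θ₂, F x (θ : ℝ) ≤ ρ * ⨅ γ, F x γ) ∨
      ∀ θ ∈ Icc θ₂ (θ₁ + p), F x (θ : ℝ) ≤ ρ * ⨅ γ, F x γ

namespace IsConnectedCost

variable {X : Type*} [TopologicalSpace X] {p : ℝ} {F : X → AddCircle p → ℝ} {κ ρ : ℝ}

theorem continuous_right (h : IsConnectedCost F κ ρ) (x : X) : Continuous (F x) :=
  h.continuous.comp (by fun_prop : Continuous fun γ => (x, γ))

theorem bddBelow (h : IsConnectedCost F κ ρ) (x : X) : BddBelow (range (F x)) :=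
  ⟨0, by rintro _ ⟨γ, rfl⟩; exact h.nonneg x γ⟩

theorem iInf_nonneg (h : IsConnectedCost F κ ρ) (x : X) : 0 ≤ ⨅ γ, F x γ :=
  Real.iInf_nonneg (h.nonneg x)

theorem iInf_le (h : IsConnectedCost F κ ρ) (x : X) (γ : AddCircle p) : ⨅ γ, F x γ ≤ F x γ :=
  ciInf_le (h.bddBelow x) γ

variable [hp : Fact (0 < p)]

theorem bddAbove (h : IsConnectedCost F κ ρ) (x : X) : BddAbove (range (F x)) :=
  (isCompact_range (h.continuous_right x)).bddAbove

theorem exists_eq_iInf (h : IsConnectedCost F κ ρ) (x : X) : ∃ γ, F x γ = ⨅ γ, F x γ := by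
  have := (isCompact_range (h.continuous_right x)).sInf_mem (range_nonempty _)
  exact this

theorem continuous_iInf (h : IsConnectedCost F κ ρ) : Continuous fun x => ⨅ γ, F x γ := by
  have := isCompact_univ.continuous_sInf (f := F) (K := univ) h.continuous
  simpa only [image_univ, sInf_range] using this

theorem continuous_iSup (h : IsConnectedCost F κ ρ) : Continuous fun x => ⨆ γ, F x γ := by
  have := isCompact_univ.continuous_sSup (f := F) (K := univ) h.continuous
  simpa only [image_univ, sSup_range] using this

theorem iSup_pos (h : IsConnectedCost F κ ρ) (x : X) : 0 < ⨆ γ, F x γ := by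
  by_contra hle
  have h0 : ∀ γ, F x γ = 0 := fun γ =>
    le_antisymm ((le_ciSup (h.bddAbove x) γ).trans (not_lt.1 hle)) (h.nonneg x γ)
  have := h.unique_zero x ((0 : ℝ) : AddCircle p) ((p / 2 : ℝ) : AddCircle p) (h0 _) (h0 _)
  have h2 := (AddCircle.coe_eq_coe_iff_of_mem_Ico (a := 0)
    (by constructor <;> linarith [hp.out]) (by constructor <;> linarith [hp.out])).1 this
  linarith [hp.out]

end IsConnectedCost

/-- A weight on angles that is positive exactly at those of cost less than `κ` times the minimum. -/
def nearOptWeight {X : Type*} {p : ℝ} (F : X → AddCircle p → ℝ) (κ : ℝ) (x : X) (θ : ℝ) : ℝ :=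
  max 0 (κ * (⨅ γ, F x γ) - F x (θ : ℝ))

section NearOptWeight

variable {X : Type*} {p : ℝ} {F : X → AddCircle p → ℝ} {κ : ℝ}

theorem periodic_nearOptWeight (x : X) : Function.Periodic (nearOptWeight F κ x) p := by
  intro θ
  simp [nearOptWeight]

theorem nearOptWeight_nonneg (x : X) (θ : ℝ) : 0 ≤ nearOptWeight F κ x θ := le_max_left _ _

theorem lt_of_nearOptWeight_pos {x : X} {θ : ℝ} (hw : 0 < nearOptWeight F κ x θ) :
    F x θ < κ * ⨅ γ, F x γ := by
  rcases lt_max_iff.1 hw with h | h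
  · exact absurd h (lt_irrefl 0)
  · linarith

end NearOptWeight

theorem exists_mem_Ico_lt {X : Type*} {p : ℝ} [hp : Fact (0 < p)] {F : X → AddCircle p → ℝ}
    {ρ : ℝ} {x : X}
    (hx : ρ * (⨅ γ, F x γ) < ⨆ γ, F x γ) :
    ∃ a ∈ Ico (0 : ℝ) p, ρ * (⨅ γ, F x γ) < F x a := by
  obtain ⟨γ, hγ⟩ := exists_lt_of_lt_ciSup hx
  have hγ' : γ ∈ ((↑) : ℝ → AddCircle p) '' Ico 0 (0 + p) := by
    rw [AddCircle.coe_image_Ico_eq]; trivial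
  obtain ⟨a, ha, rfl⟩ := hγ'
  exact ⟨a, by simpa using ha, hγ⟩

open Classical in
/-- The mean of the near-optimal points of the circle, cut at a point of cost more than `ρ` times
the minimum; if the minimal cost is `0`, the minimizer. -/
def meanDirection {X : Type*} {p : ℝ} (F : X → AddCircle p → ℝ) (κ ρ : ℝ) (x : X) : AddCircle p :=
  if (⨅ γ, F x γ) = 0 then Classical.epsilon fun γ => F x γ = 0
  else cutMean (nearOptWeight F κ x) p
    (Classical.epsilon fun a : ℝ => a ∈ Ico 0 p ∧ ρ * (⨅ γ, F x γ) < F x a)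

namespace IsConnectedCost

variable {X : Type*} [TopologicalSpace X] {p : ℝ} [hp : Fact (0 < p)] {F : X → AddCircle p → ℝ}
  {κ ρ : ℝ}

theorem continuous_nearOptWeight (h : IsConnectedCost F κ ρ) :
    Continuous fun q : X × ℝ => nearOptWeight F κ q.1 q.2 := by
  have h1 : Continuous fun q : X × ℝ => F q.1 (q.2 : ℝ) :=
    h.continuous.comp (continuous_fst.prodMk ((AddCircle.continuous_mk' p).comp continuous_snd))
  have h2 : Continuous fun q : X × ℝ => ⨅ γ, F q.1 γ := h.continuous_iInf.comp continuous_fst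
  exact continuous_const.max ((continuous_const.mul h2).sub h1)

theorem continuous_nearOptWeight_right (h : IsConnectedCost F κ ρ) (x : X) :
    Continuous (nearOptWeight F κ x) :=
  h.continuous_nearOptWeight.comp (by fun_prop : Continuous fun θ : ℝ => (x, θ))

theorem integral_nearOptWeight_pos (h : IsConnectedCost F κ ρ) (hκ : 1 < κ) {x : X}
    (hx : 0 < ⨅ γ, F x γ) (a : ℝ) : 0 < ∫ θ in a..a + p, nearOptWeight F κ x θ := by
  obtain ⟨γ, hγ⟩ := h.exists_eq_iInf x
  have hγ' : γ ∈ ((↑) : ℝ → AddCircle p) '' Ico a (a + p) := by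
    rw [AddCircle.coe_image_Ico_eq]; trivial
  obtain ⟨θ, hθ, rfl⟩ := hγ'
  refine intervalIntegral.integral_pos (by linarith [hp.out])
    (h.continuous_nearOptWeight_right x).continuousOn (fun θ _ => nearOptWeight_nonneg x θ)
    ⟨θ, Ico_subset_Icc_self hθ, lt_max_of_lt_right ?_⟩
  rw [hγ]
  nlinarith

/-- The cut mean of the near-optimal points stays within the low-cost arc that contains them. -/
theorem cutMean_le (h : IsConnectedCost F κ ρ) (hκ : 1 < κ) {x : X} (hx : 0 < ⨅ γ, F x γ) {a : ℝ}
    (ha : ρ * (⨅ γ, F x γ) < F x a) :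
    F x (cutMean (nearOptWeight F κ x) p a : ℝ) ≤ ρ * ⨅ γ, F x γ := by
  have hw := h.continuous_nearOptWeight_right x
  have hW := h.integral_nearOptWeight_pos hκ hx a
  obtain ⟨θ₁, hθ₁, hle₁, hpos₁⟩ := exists_pos_le_cutMean hp.out hw (nearOptWeight_nonneg x) hW
  obtain ⟨θ₂, hθ₂, hle₂, hpos₂⟩ := exists_pos_ge_cutMean hp.out hw (nearOptWeight_nonneg x) hW
  rcases h.connected x θ₁ θ₂ hx (hle₁.trans hle₂) (by linarith [hθ₁.1, hθ₂.2])
    (lt_of_nearOptWeight_pos hpos₁).le (lt_of_nearOptWeight_pos hpos₂).le with h1 | h1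
  · exact h1 _ ⟨hle₁, hle₂⟩
  · have := h1 (a + p) ⟨hθ₂.2, by linarith [hθ₁.1]⟩
    rw [AddCircle.coe_add_period] at this
    exact absurd ha (not_lt.2 this)

/-- All high-cost points lie in the same gap between near-optimal points, so that the cut mean does
not depend on the cut. -/
theorem coe_cutMean_eq_of_le (h : IsConnectedCost F κ ρ) (hκ : 1 < κ) {x : X}
    (hx : 0 < ⨅ γ, F x γ) {a a' : ℝ} (ha : ρ * (⨅ γ, F x γ) < F x a)
    (ha' : ρ * (⨅ γ, F x γ) < F x a') (h1 : a ≤ a') (h2 : a' ≤ a + p) :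
    (cutMean (nearOptWeight F κ x) p a' : AddCircle p) = cutMean (nearOptWeight F κ x) p a := by
  refine coe_cutMean_eq (h.continuous_nearOptWeight_right x) (periodic_nearOptWeight x)
    (h.integral_nearOptWeight_pos hκ hx a) h1 h2 ?_
  by_contra! hne
  obtain ⟨⟨θ₁, hθ₁, hne₁⟩, θ₂, hθ₂, hne₂⟩ := hne
  have hpos₁ := (nearOptWeight_nonneg x θ₁).lt_of_ne' hne₁
  have hpos₂ := (nearOptWeight_nonneg x θ₂).lt_of_ne' hne₂
  rcases h.connected x θ₁ θ₂ hx (hθ₁.2.trans hθ₂.1) (by linarith [hθ₁.1, hθ₂.2])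
    (lt_of_nearOptWeight_pos hpos₁).le (lt_of_nearOptWeight_pos hpos₂).le with h3 | h3
  · exact absurd ha' (not_lt.2 (h3 _ ⟨hθ₁.2, hθ₂.1⟩))
  · have := h3 (a + p) ⟨hθ₂.2, by linarith [hθ₁.1]⟩
    rw [AddCircle.coe_add_period] at this
    exact absurd ha (not_lt.2 this)

theorem meanDirection_eq (h : IsConnectedCost F κ ρ) (hκ : 1 < κ) {x : X}
    (hx : 0 < ⨅ γ, F x γ) {a : ℝ} (ha : a ∈ Ico 0 p) (hbad : ρ * (⨅ γ, F x γ) < F x a) :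
    meanDirection F κ ρ x = cutMean (nearOptWeight F κ x) p a := by
  rw [meanDirection, if_neg hx.ne']
  have hex : ∃ a : ℝ, a ∈ Ico 0 p ∧ ρ * (⨅ γ, F x γ) < F x a := ⟨a, ha, hbad⟩
  obtain ⟨hb, hb'⟩ := Classical.epsilon_spec hex
  rcases le_total a (Classical.epsilon fun a : ℝ => a ∈ Ico 0 p ∧ ρ * (⨅ γ, F x γ) < F x a)
    with hle | hle
  · exact h.coe_cutMean_eq_of_le hκ hx hbad hb' hle (by linarith [ha.1, hb.2])
  · exact (h.coe_cutMean_eq_of_le hκ hx hb' hbad hle (by linarith [ha.2, hb.1])).symm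

theorem meanDirection_le (h : IsConnectedCost F κ ρ) (hκ : 1 < κ) {x : X}
    (hx : ρ * (⨅ γ, F x γ) < ⨆ γ, F x γ) :
    F x (meanDirection F κ ρ x) ≤ ρ * ⨅ γ, F x γ := by
  rcases (h.iInf_nonneg x).eq_or_lt with h0 | h0
  · have hex : ∃ γ, F x γ = 0 := by
      obtain ⟨γ, hγ⟩ := h.exists_eq_iInf x
      exact ⟨γ, hγ.trans h0.symm⟩
    rw [meanDirection, if_pos h0.symm, Classical.epsilon_spec hex, ← h0, mul_zero]
  · obtain ⟨a, ha, hbad⟩ := exists_mem_Ico_lt hx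
    rw [h.meanDirection_eq hκ h0 ha hbad]
    exact h.cutMean_le hκ h0 hbad

theorem continuousAt_cutMean (h : IsConnectedCost F κ ρ) (hκ : 1 < κ) {x : X}
    (hx : 0 < ⨅ γ, F x γ) (a : ℝ) :
    ContinuousAt (fun y => cutMean (nearOptWeight F κ y) p a) x := by
  have hw := h.continuous_nearOptWeight
  have h1 : Continuous fun y => ∫ θ in a..a + p, nearOptWeight F κ y θ :=
    intervalIntegral.continuous_parametric_intervalIntegral_of_continuous' hw _ _
  have h2 : Continuous fun y => ∫ θ in a..a + p, θ * nearOptWeight F κ y θ :=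
    intervalIntegral.continuous_parametric_intervalIntegral_of_continuous'
      (f := fun y θ => θ * nearOptWeight F κ y θ) (continuous_snd.mul hw) _ _
  exact h2.continuousAt.div h1.continuousAt (h.integral_nearOptWeight_pos hκ hx a).ne'

/-- Where the cost has a zero, points of cost within a constant factor of the minimum converge to
that zero. -/
theorem tendsto_of_le_of_iInf_eq_zero (h : IsConnectedCost F κ ρ) {x : X} {l : Filter X}
    (hl : l ≤ 𝓝 x) (hx : (⨅ γ, F x γ) = 0) {dir : X → AddCircle p} {C : ℝ}
    (hdir : ∀ᶠ y in l, F y (dir y) ≤ C * ⨅ γ, F y γ) {γ₀ : AddCircle p} (hγ₀ : F x γ₀ = 0) :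
    Tendsto dir l (𝓝 γ₀) := by
  rw [tendsto_nhds]
  intro U hU hmem
  have hcont : Continuous fun q : X × AddCircle p => F q.1 q.2 - C * ⨅ γ, F q.1 γ :=
    h.continuous.sub (continuous_const.mul (h.continuous_iInf.comp continuous_fst))
  have hev : ∀ᶠ y in 𝓝 x, ∀ γ ∈ Uᶜ, 0 < F y γ - C * ⨅ γ, F y γ := by
    refine hU.isClosed_compl.isCompact.eventually_forall_of_forall_eventually fun γ hγ => ?_
    refine hcont.continuousAt.eventually_const_lt ?_
    simp only [hx, mul_zero, sub_zero]
    refine (h.nonneg x γ).lt_of_ne fun h0 => hγ ?_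
    rwa [h.unique_zero x γ γ₀ h0.symm hγ₀]
  filter_upwards [hdir, hl hev] with y hy hy'
  by_contra hnot
  linarith [hy' _ hnot]

theorem continuousOn_meanDirection (h : IsConnectedCost F κ ρ) (hκ : 1 < κ) :
    ContinuousOn (meanDirection F κ ρ) {x | ρ * (⨅ γ, F x γ) < ⨆ γ, F x γ} := by
  intro x hx
  rcases (h.iInf_nonneg x).eq_or_lt with h0 | h0
  · have hle := h.meanDirection_le hκ hx
    rw [← h0, mul_zero] at hle
    exact h.tendsto_of_le_of_iInf_eq_zero nhdsWithin_le_nhds h0.symm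
      (eventually_nhdsWithin_of_forall fun y hy => h.meanDirection_le hκ hy)
      (le_antisymm hle (h.nonneg _ _))
  · obtain ⟨a, ha, hbad⟩ := exists_mem_Ico_lt hx
    have hev : ∀ᶠ y in 𝓝 x, 0 < ⨅ γ, F y γ := h.continuous_iInf.continuousAt.eventually_const_lt h0
    have hcont : Continuous fun y => F y a - ρ * ⨅ γ, F y γ :=
      (h.continuous.comp (by fun_prop : Continuous fun y => (y, (a : AddCircle p)))).sub
        (continuous_const.mul h.continuous_iInf)
    have hev' : ∀ᶠ y in 𝓝 x, 0 < F y a - ρ * ⨅ γ, F y γ :=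
      hcont.continuousAt.eventually_const_lt (sub_pos.2 hbad)
    have hmean : ContinuousAt
        (fun y => (cutMean (nearOptWeight F κ y) p a : AddCircle p)) x :=
      (AddCircle.continuous_mk' p).continuousAt.comp (h.continuousAt_cutMean hκ h0 a)
    refine (hmean.congr ?_).continuousWithinAt
    filter_upwards [hev, hev'] with y hy hy'
    exact (h.meanDirection_eq hκ hy ha (sub_pos.1 hy')).symm

/-- A connected cost can be kept causally and continuously within a factor of the minimum: any
factor above `ρ` will do. -/
theorem exists_causal_approx (h : IsConnectedCost F κ ρ) (hκ : 1 < κ) (hρ : 0 < ρ) {ρ' : ℝ}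
    (hρ' : ρ < ρ') :
    ∃ out : (ℝ → X) → ℝ → ℝ,
      (∀ c, Continuous c → ContinuousOn (out c) (Ici 0)) ∧
      (∀ c c' t, (∀ u ∈ Icc 0 t, c u = c' u) → 0 ≤ t → out c t = out c' t) ∧
      (∀ c t, Continuous c → 0 ≤ t → F (c t) (out c t : ℝ) ≤ ρ' * ⨅ γ, F (c t) γ) := by
  -- `lam` is at least `0` only where some cost exceeds `ρ` times the minimum, and less than `1`
  -- only where all costs are at most `ρ'` times the minimum
  obtain ⟨σ, hσ, hσ'⟩ := exists_between hρ'
  set lam : X → ℝ := fun x =>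
    ρ' * ((⨆ γ, F x γ) - σ * ⨅ γ, F x γ) / ((ρ' - σ) * ⨆ γ, F x γ) with hlam
  have hden : ∀ x, 0 < (ρ' - σ) * ⨆ γ, F x γ := fun x =>
    mul_pos (sub_pos.2 hσ') (h.iSup_pos x)
  have hlamc : Continuous lam := by
    have h1 := h.continuous_iInf
    have h2 := h.continuous_iSup
    exact (continuous_const.mul (h2.sub (continuous_const.mul h1))).div
      (continuous_const.mul h2) fun x => (hden x).ne'
  have hbad : ∀ x, 0 ≤ lam x → ρ * (⨅ γ, F x γ) < ⨆ γ, F x γ := fun x hx => by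
    have h1 : 0 ≤ ρ' * ((⨆ γ, F x γ) - σ * ⨅ γ, F x γ) := by
      by_contra hneg
      exact absurd hx (not_le.2 (div_neg_of_neg_of_pos (not_le.1 hneg) (hden x)))
    have h2 : 0 ≤ (⨆ γ, F x γ) - σ * ⨅ γ, F x γ :=
      nonneg_of_mul_nonneg_right h1 (by linarith)
    rcases (h.iInf_nonneg x).eq_or_lt with h0 | h0
    · rw [← h0, mul_zero]
      exact h.iSup_pos x
    · nlinarith
  obtain ⟨out, hout, hcausal, htrack⟩ := exists_causal_tracking hlamc
    ((h.continuousOn_meanDirection hκ).mono fun x (hx : 0 ≤ lam x) => hbad x hx)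
  refine ⟨out, hout, hcausal, fun c t hc ht => ?_⟩
  rcases lt_or_ge (lam (c t)) 1 with hlt | hge
  · rw [hlam, div_lt_one (hden _)] at hlt
    have h1 := le_ciSup (h.bddAbove (c t)) (out c t : AddCircle p)
    have h2 : σ * ((⨆ γ, F (c t) γ) - ρ' * ⨅ γ, F (c t) γ) < 0 := by linarith
    nlinarith
  · rw [htrack c t hc ht hge]
    refine (h.meanDirection_le hκ (hbad _ (by linarith))).trans ?_
    exact mul_le_mul_of_nonneg_right hρ'.le (h.iInf_nonneg _)

end IsConnectedCost

/-! ### Real inequalities behind the constant `5 / 4` -/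

theorem convex_quadratic_nonpos {r k p : ℝ} (hr : r ≤ p) (hp : p ≤ 1)
    (h1 : 2 * r ^ 2 - k * r + 2 ≤ 0) (h2 : 4 - k ≤ 0) : 2 * p ^ 2 - k * p + 2 ≤ 0 := by
  rcases hp.eq_or_lt with rfl | hlt
  · linarith
  · have h3 : (1 - r) * (2 * p ^ 2 - k * p + 2) =
        (1 - p) * (2 * r ^ 2 - k * r + 2) + (p - r) * (4 - k) - 2 * (1 - r) * (1 - p) * (p - r) := by
      ring
    have h4 : 0 ≤ (1 - r) * (1 - p) * (p - r) :=
      mul_nonneg (mul_nonneg (by linarith) (by linarith)) (by linarith)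
    have h5 : (1 - r) * (2 * p ^ 2 - k * p + 2) ≤ 0 := by
      nlinarith [mul_nonneg (sub_nonneg.2 hp) (neg_nonneg.2 h1),
        mul_nonneg (sub_nonneg.2 hr) (neg_nonneg.2 h2)]
    by_contra hpos
    nlinarith [mul_pos (by linarith : 0 < 1 - r) (not_le.1 hpos)]

/-- The inequality behind the constant `5 / 4`, with equality at `C = 4 / 5`, `S = 3 / 5`,
`p = 1 / 2`, `q = 1`. -/
theorem mul_add_mul_le_one {C S p q : ℝ} (hCS : C ^ 2 + S ^ 2 = 1) (hS : 0 ≤ S) (hle : S ≤ C)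
    (hp1 : p ≤ 1) (hq1 : q ≤ 1) (hp : 0 < 2 * p ^ 2 - (1 + 5 * C) * p + 2)
    (hq : 0 < 2 * q ^ 2 - (1 + 5 * S) * q + 2) : p * C + q * S ≤ 1 := by
  have hC : 7 / 10 < C := by nlinarith
  have hC1 : C ≤ 1 := by nlinarith
  rcases le_or_gt (4 / 5) C with h | h
  · have hlt : p < (1 - S) / C := by
      by_contra hge
      refine absurd hp (not_lt.2 (convex_quadratic_nonpos (not_lt.1 hge) hp1 ?_ (by linarith)))
      have hS1 : 0 ≤ 1 - S := by nlinarith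
      have h1 : 2 * ((1 - S) / C) ^ 2 - (1 + 5 * C) * ((1 - S) / C) + 2 =
          (1 - S) * (4 - (1 + 5 * C) * C) / C ^ 2 := by
        field_simp
        linear_combination 2 * hCS
      rw [h1]
      exact div_nonpos_of_nonpos_of_nonneg
        (mul_nonpos_of_nonneg_of_nonpos hS1 (by nlinarith)) (sq_nonneg C)
    rw [lt_div_iff₀ (by linarith)] at hlt
    nlinarith
  · have hS3 : 3 / 5 < S := by nlinarith
    -- linear upper bounds for `p` and `q`, exact at `C = 4 / 5`
    have hpl : p < 1 / 2 + 6 / 5 * (4 / 5 - C) := by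
      by_contra hge
      refine absurd hp (not_lt.2 (convex_quadratic_nonpos (not_lt.1 hge) hp1 ?_ (by linarith)))
      nlinarith
    have hS4 : S ≤ 18 / 25 := by nlinarith
    have hql : q < 1 - 3 * (S - 3 / 5) := by
      by_contra hge
      refine absurd hq (not_lt.2 (convex_quadratic_nonpos (not_lt.1 hge) hq1 ?_ (by linarith)))
      nlinarith
    have h1 := mul_lt_mul_of_pos_right hpl (by linarith : 0 < C)
    have h2 := mul_lt_mul_of_pos_right hql (by linarith : 0 < S)
    linarith [sq_nonneg (4 / 5 - C), sq_nonneg (S - 3 / 5)]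

/-- A form of `mul_add_mul_le_one` with slack `δ`: its two quadratic conditions say that
`p + 1 / p > (1 + 5 * C) / 2` and `q + 1 / q > (1 + 5 * S) / 2`. -/
theorem sum_inv_le_of_le {C S p q δ : ℝ} (hCS : C ^ 2 + S ^ 2 = 1) (hS : 0 ≤ S) (hle : S ≤ C)
    (hp0 : 0 < p) (hp1 : p ≤ 1) (hq0 : 0 < q) (hq1 : q ≤ 1) (hδ : 0 < δ) (hδ1 : δ ≤ 1 / 100)
    (hsum : 1 - δ / 2 ≤ p * C + q * S) :
    p + 1 / p ≤ (1 + 5 * C) / 2 + 16 * δ ∨ q + 1 / q ≤ (1 + 5 * S) / 2 + 16 * δ := by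
  by_contra! h
  obtain ⟨hp, hq⟩ := h
  have hC : 7 / 10 < C := by nlinarith
  have hC1 : C ≤ 1 := by nlinarith
  have hS1 : S ≤ 71 / 100 := by nlinarith
  have hp4 : 1 / 4 ≤ p := by
    linarith [mul_le_of_le_one_left hS hq1, mul_le_of_le_one_right hp0.le hC1]
  have hpm : 0 < 2 * p ^ 2 - (1 + 5 * C + 32 * δ) * p + 2 := by
    have h1 : p + 1 / p - ((1 + 5 * C) / 2 + 16 * δ) =
        (2 * p ^ 2 - (1 + 5 * C + 32 * δ) * p + 2) / (2 * p) := by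
      field_simp
      ring
    have h2 : 0 < (2 * p ^ 2 - (1 + 5 * C + 32 * δ) * p + 2) / (2 * p) := by
      rw [← h1]; linarith
    exact (div_pos_iff_of_pos_right (by linarith)).1 h2
  have hqm : 0 < 2 * q ^ 2 - (1 + 5 * S) * q + 2 := by
    have h1 : q + 1 / q - ((1 + 5 * S) / 2) =
        (2 * q ^ 2 - (1 + 5 * S) * q + 2) / (2 * q) := by
      field_simp
      ring
    have h2 : 0 < (2 * q ^ 2 - (1 + 5 * S) * q + 2) / (2 * q) := by
      rw [← h1]; linarith
    exact (div_pos_iff_of_pos_right (by linarith)).1 h2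
  have hp7 : p ≤ 7 / 10 := by
    by_contra hgt
    exact absurd hpm (not_lt.2 (convex_quadratic_nonpos (not_le.1 hgt).le hp1
      (by linarith) (by linarith)))
  -- the strict slack allows `p` to be increased by `δ`
  have h1 : 0 < δ * (36 * p - 1 - 5 * C) := mul_pos hδ (by linarith)
  have h2 := mul_add_mul_le_one (p := p + δ) hCS hS hle (by linarith) hq1
    (by linarith [sq_nonneg δ]) hqm
  linarith [mul_lt_mul_of_pos_left hC hδ]

/-- For numbers `x`, `y` of product at most `1` and `X`, `Y` of product at most `1`, coupled by four
inequalities, one of the sums `x + y` and `X + Y` is small. -/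
theorem sum_le_or_sum_le {C S x y X Y δ : ℝ} (hCS : C ^ 2 + S ^ 2 = 1) (hC : 0 ≤ C) (hS : 0 ≤ S)
    (hx : 0 < x) (hy : 0 < y) (hX : 0 < X) (hY : 0 < Y) (hxy : x * y ≤ 1) (hXY : X * Y ≤ 1)
    (hδ : 0 < δ) (hδ1 : δ ≤ 1 / 100)
    (hxX : 1 - δ / 2 ≤ x * C + X * S) (hxY : 1 - δ / 2 ≤ x * C + Y * S)
    (hyX : 1 - δ / 2 ≤ y * C + X * S) (hyY : 1 - δ / 2 ≤ y * C + Y * S) :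
    x + y ≤ (1 + 5 * C) / 2 + 16 * δ ∨ X + Y ≤ (1 + 5 * S) / 2 + 16 * δ := by
  wlog h1 : x ≤ y generalizing x y
  · rw [add_comm x y]
    exact this hy hx (by rwa [mul_comm]) hyX hyY hxX hxY (le_of_not_ge h1)
  wlog h2 : X ≤ Y generalizing X Y
  · rw [add_comm X Y]
    exact this hY hX (by rwa [mul_comm]) hxY hxX hyY hyX (le_of_not_ge h2)
  have hx1 : x ≤ 1 := by nlinarith
  have hX1 : X ≤ 1 := by nlinarith
  have hy1 : y ≤ 1 / x := by rw [le_div_iff₀ hx]; linarith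
  have hY1 : Y ≤ 1 / X := by rw [le_div_iff₀ hX]; linarith
  rcases le_total S C with h | h
  · rcases sum_inv_le_of_le hCS hS h hx hx1 hX hX1 hδ hδ1 hxX with h3 | h3
    · left; linarith
    · right; linarith
  · rcases sum_inv_le_of_le (by linarith) hC h hX hX1 hx hx1 hδ hδ1 (by linarith) with h3 | h3
    · right; linarith
    · left; linarith

/-- If the boxes at the ends of an arc of cosine `C` and sine `S` have sides `a`, `b` and `c`, `d`,
then the left-hand side bounds `S ^ 2` times the area of a box at angles with sines `S₂` and `S₁` to
the ends. The worst case is the midpoint `S₁ = S₂`. -/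
theorem box_product_le {C S S₁ S₂ a b c d K δ : ℝ} (hC : 0 ≤ C)
    (hS₁ : 0 ≤ S₁) (hS₂ : 0 ≤ S₂) (h : S₁ ^ 2 + S₂ ^ 2 + 2 * C * (S₁ * S₂) = S ^ 2)
    (hδ : 0 ≤ δ) (hK : 0 ≤ K) (hab : a * b ≤ K) (hcd : c * d ≤ K)
    (hE : a * d + b * c ≤ K * ((1 + 5 * C) / 2 + 16 * δ)) :
    (S₁ * a + S₂ * c) * (S₁ * b + S₂ * d) ≤ K * (5 / 4 + 8 * δ) * S ^ 2 := by
  have h0 : 0 ≤ S₁ * S₂ := mul_nonneg hS₁ hS₂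
  have h1 : 2 * (1 + C) * (S₁ * S₂) ≤ S ^ 2 := by nlinarith [sq_nonneg (S₁ - S₂)]
  have h2 : (S₁ * a + S₂ * c) * (S₁ * b + S₂ * d) ≤
      K * S₁ ^ 2 + K * S₂ ^ 2 + K * ((1 + 5 * C) / 2 + 16 * δ) * (S₁ * S₂) := by
    nlinarith [mul_le_mul_of_nonneg_right hab (sq_nonneg S₁),
      mul_le_mul_of_nonneg_right hcd (sq_nonneg S₂), mul_le_mul_of_nonneg_right hE h0]
  have h3 : S₁ ^ 2 + S₂ ^ 2 + ((1 + 5 * C) / 2 + 16 * δ) * (S₁ * S₂) ≤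
      (5 / 4 + 8 * δ) * S ^ 2 := by
    nlinarith [mul_nonneg hδ h0, mul_nonneg hC h0, mul_nonneg hδ (mul_nonneg hC h0)]
  nlinarith [mul_le_mul_of_nonneg_left h3 hK]

/-! ### Extents of point sets -/

theorem inner_unitVec (x : Plane) (θ : ℝ) :
    inner ℝ x (unitVec θ) = x 0 * Real.cos θ + x 1 * Real.sin θ := by
  rw [PiLp.inner_apply, Fin.sum_univ_two]
  simp [unitVec, mul_comm]

section Extent

variable {n : ℕ}

theorem le_extent (v : Plane) (P : Fin n → Plane) (i j : Fin n) :
    inner ℝ (P i - P j) v ≤ extent v P :=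
  le_ciSup (f := fun pq : Fin n × Fin n => inner ℝ (P pq.1 - P pq.2) v)
    (Set.finite_range _).bddAbove (i, j)

theorem extent_le {v : Plane} {P : Fin n → Plane} {c : ℝ} (hc : 0 ≤ c)
    (h : ∀ i j, inner ℝ (P i - P j) v ≤ c) : extent v P ≤ c :=
  Real.iSup_le (fun pq => h pq.1 pq.2) hc

theorem extent_nonneg (v : Plane) (P : Fin n → Plane) : 0 ≤ extent v P := by
  rcases isEmpty_or_nonempty (Fin n) with h | ⟨⟨i⟩⟩
  · exact (Real.iSup_of_isEmpty _).ge
  · simpa using le_extent v P i i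

theorem extent_add_pi (θ : ℝ) (P : Fin n → Plane) :
    extent (unitVec (θ + Real.pi)) P = extent (unitVec θ) P := by
  rw [unitVec_add_pi, extent_neg]

theorem continuous_extent :
    Continuous fun q : (Fin n → Plane) × ℝ => extent (unitVec q.2) q.1 := by
  rcases isEmpty_or_nonempty (Fin n × Fin n) with h | h
  · simp only [extent, Real.iSup_of_isEmpty]
    exact continuous_const
  · simp only [extent, ← Finset.sup'_univ_eq_ciSup]
    refine Continuous.finset_sup'_apply _ fun pq _ => ?_
    simp only [inner_unitVec]
    fun_prop

theorem continuous_extent_comp {X : Type*} [TopologicalSpace X] {P : X → Fin n → Plane} {θ : X → ℝ}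
    (hP : Continuous P) (hθ : Continuous θ) :
    Continuous fun x => extent (unitVec (θ x)) (P x) := by
  have h := continuous_extent.comp (hP.prodMk hθ)
  exact h

/-- The extent is a seminorm of the direction: on an arc it is bounded by its values at the ends. -/
theorem sin_mul_extent_le (P : Fin n → Plane) {θ₁ θ₂ θ : ℝ} (h1 : θ₁ ≤ θ) (h2 : θ ≤ θ₂)
    (h3 : θ₂ ≤ θ₁ + Real.pi) :
    Real.sin (θ₂ - θ₁) * extent (unitVec θ) P ≤
      Real.sin (θ₂ - θ) * extent (unitVec θ₁) P + Real.sin (θ - θ₁) * extent (unitVec θ₂) P := by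
  have hs1 : 0 ≤ Real.sin (θ₂ - θ) :=
    Real.sin_nonneg_of_nonneg_of_le_pi (by linarith) (by linarith)
  have hs2 : 0 ≤ Real.sin (θ - θ₁) :=
    Real.sin_nonneg_of_nonneg_of_le_pi (by linarith) (by linarith)
  have hs : 0 ≤ Real.sin (θ₂ - θ₁) :=
    Real.sin_nonneg_of_nonneg_of_le_pi (by linarith) (by linarith)
  have hnn : 0 ≤ Real.sin (θ₂ - θ) * extent (unitVec θ₁) P +
      Real.sin (θ - θ₁) * extent (unitVec θ₂) P :=
    add_nonneg (mul_nonneg hs1 (extent_nonneg _ _)) (mul_nonneg hs2 (extent_nonneg _ _))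
  rcases hs.eq_or_lt with h0 | h0
  · rwa [← h0, zero_mul]
  rw [← le_div_iff₀' h0]
  refine extent_le (div_nonneg hnn hs) fun i j => ?_
  rw [le_div_iff₀' h0]
  have e1 := mul_le_mul_of_nonneg_left (le_extent (unitVec θ₁) P i j) hs1
  have e2 := mul_le_mul_of_nonneg_left (le_extent (unitVec θ₂) P i j) hs2
  refine le_trans (le_of_eq ?_) (add_le_add e1 e2)
  simp only [inner_unitVec, Real.sin_sub]
  ring

theorem abs_inner_le_extent (v : Plane) (P : Fin n → Plane) (i j : Fin n) :
    |inner ℝ (P i - P j) v| ≤ extent v P := by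
  refine abs_le.2 ⟨?_, le_extent v P i j⟩
  have := le_extent v P j i
  rw [← neg_sub, inner_neg_left] at this
  linarith

theorem extent_pos_of_inner_ne_zero {v : Plane} {P : Fin n → Plane} {i j : Fin n}
    (h : inner ℝ (P i - P j) v ≠ 0) : 0 < extent v P :=
  (abs_pos.2 h).trans_le (abs_inner_le_extent v P i j)

end Extent

theorem sin_eq_zero_of_inner_unitVec {x : Plane} (hx : x ≠ 0) {θ θ' : ℝ}
    (h : inner ℝ x (unitVec θ) = 0) (h' : inner ℝ x (unitVec θ') = 0) :
    Real.sin (θ' - θ) = 0 := by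
  rw [inner_unitVec] at h h'
  by_contra hs
  rw [Real.sin_sub] at hs
  refine hx ?_
  have h0 : x 0 = 0 := by
    refine (mul_eq_zero.1 (?_ : x 0 * (Real.sin θ' * Real.cos θ - Real.cos θ' * Real.sin θ) = 0)
      ).resolve_right hs
    linear_combination Real.sin θ' * h - Real.sin θ * h'
  have h1 : x 1 = 0 := by
    refine (mul_eq_zero.1 (?_ : x 1 * (Real.sin θ' * Real.cos θ - Real.cos θ' * Real.sin θ) = 0)
      ).resolve_right hs
    linear_combination Real.cos θ * h' - Real.cos θ' * h
  ext i
  fin_cases i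
  · exact h0
  · exact h1

theorem coe_eq_coe_of_sin_sub_eq_zero {θ θ' : ℝ} (h : Real.sin (θ' - θ) = 0) :
    (θ : AddCircle Real.pi) = (θ' : AddCircle Real.pi) := by
  obtain ⟨k, hk⟩ := Real.sin_eq_zero_iff.1 h
  rw [eq_comm, ← sub_eq_zero, ← AddCircle.coe_sub, AddCircle.coe_eq_zero_iff]
  exact ⟨k, by rw [← hk]; simp⟩

/-- A cost on angles that is jointly continuous is jointly continuous on the circle. -/
theorem continuous_of_continuous_coe {X : Type*} [TopologicalSpace X] {p : ℝ}
    {F : X → AddCircle p → ℝ} (h : Continuous fun q : X × ℝ => F q.1 (q.2 : ℝ)) :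
    Continuous fun q : X × AddCircle p => F q.1 q.2 := by
  have hq : IsOpenQuotientMap (Prod.map id ((↑) : ℝ → AddCircle p) : X × ℝ → X × AddCircle p) :=
    IsOpenQuotientMap.id.prodMap QuotientAddGroup.isOpenQuotientMap_mk
  exact hq.continuous_comp_iff.1 h

/-- The admissible positions of `n` points: not all at the same place. -/
abbrev Config (n : ℕ) : Type := {P : Fin n → Plane // ∃ i j, P i ≠ P j}

theorem Config.coe_eq_coe_of_extent_eq_zero {n : ℕ} (P : Config n) {θ θ' : ℝ}
    (h : extent (unitVec θ) P.1 = 0) (h' : extent (unitVec θ') P.1 = 0) :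
    (θ : AddCircle Real.pi) = (θ' : AddCircle Real.pi) := by
  obtain ⟨P, i, j, hij⟩ := P
  have key : ∀ {θ}, extent (unitVec θ) P = 0 → inner ℝ (P i - P j) (unitVec θ) = 0 := by
    intro θ h
    by_contra hne
    exact (extent_pos_of_inner_ne_zero hne).ne' h
  exact coe_eq_coe_of_sin_sub_eq_zero
    (sin_eq_zero_of_inner_unitVec (sub_ne_zero.2 hij) (key h) (key h'))

/-! ### Covering strips and bounding boxes -/

instance fact_pi_pos : Fact (0 < Real.pi) := ⟨Real.pi_pos⟩

instance fact_pi_div_two_pos : Fact (0 < Real.pi / 2) := ⟨by positivity⟩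

theorem exists_coe_eq {p : ℝ} (γ : AddCircle p) : ∃ θ : ℝ, (θ : AddCircle p) = γ :=
  QuotientAddGroup.mk_surjective γ

section Strip

theorem STRIP_coe {n : ℕ} (θ : ℝ) (P : Fin n → Plane) :
    STRIP n (θ : Orientation) P = extent (unitVec (θ + Real.pi / 2)) P := rfl

theorem sin_sub_add_sin_le {β t : ℝ} (h0 : 0 ≤ β) (h1 : β ≤ Real.pi / 2) :
    Real.sin (β - t) + Real.sin t ≤ Real.sqrt 2 * Real.sin β := by
  have e1 : Real.sin (β - t) + Real.sin t =
      2 * Real.sin (β / 2) * Real.cos (β / 2 - t) := by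
    have h1 : Real.sin (β - t) = Real.sin (β / 2 + (β / 2 - t)) := by congr 1; ring
    have h2 : Real.sin t = Real.sin (β / 2 - (β / 2 - t)) := by congr 1; ring
    rw [h1, h2, Real.sin_add, Real.sin_sub (β / 2) (β / 2 - t)]
    ring
  have e2 : Real.sin β = 2 * Real.sin (β / 2) * Real.cos (β / 2) := by
    rw [← Real.sin_two_mul]; congr 1; ring
  have hs : 0 ≤ Real.sin (β / 2) :=
    Real.sin_nonneg_of_nonneg_of_le_pi (by linarith) (by linarith [Real.pi_pos])
  have hc : Real.sqrt 2 / 2 ≤ Real.cos (β / 2) := by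
    rw [← Real.cos_pi_div_four]
    exact Real.cos_le_cos_of_nonneg_of_le_pi (by linarith) (by linarith [Real.pi_pos])
      (by linarith)
  have h2 : Real.sqrt 2 * Real.sqrt 2 = 2 := Real.mul_self_sqrt zero_le_two
  have h3 : 1 ≤ Real.sqrt 2 * Real.cos (β / 2) := by
    nlinarith [mul_le_mul_of_nonneg_left hc (Real.sqrt_nonneg 2)]
  rw [e1, e2]
  nlinarith [mul_le_mul_of_nonneg_left ((Real.cos_le_one (β / 2 - t)).trans h3)
    (mul_nonneg zero_le_two hs)]

theorem extent_le_sqrt_two_mul {n : ℕ} (P : Fin n → Plane) {θ₁ θ₂ θ L : ℝ} (h1 : θ₁ ≤ θ)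
    (h2 : θ ≤ θ₂) (h3 : θ₂ - θ₁ ≤ Real.pi / 2) (hL₁ : extent (unitVec θ₁) P ≤ L)
    (hL₂ : extent (unitVec θ₂) P ≤ L) : extent (unitVec θ) P ≤ Real.sqrt 2 * L := by
  have hL : 0 ≤ L := (extent_nonneg _ _).trans hL₁
  rcases (h1.trans h2).eq_or_lt with h | h
  · obtain rfl : θ = θ₁ := le_antisymm (h2.trans h.ge) h1
    have : 1 ≤ Real.sqrt 2 := Real.one_le_sqrt.2 one_le_two
    nlinarith
  · have hs : 0 < Real.sin (θ₂ - θ₁) :=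
      Real.sin_pos_of_pos_of_lt_pi (by linarith) (by linarith [Real.pi_pos])
    have hs1 : 0 ≤ Real.sin (θ₂ - θ) :=
      Real.sin_nonneg_of_nonneg_of_le_pi (by linarith) (by linarith [Real.pi_pos])
    have hs2 : 0 ≤ Real.sin (θ - θ₁) :=
      Real.sin_nonneg_of_nonneg_of_le_pi (by linarith) (by linarith [Real.pi_pos])
    have e1 := sin_mul_extent_le P h1 h2 (by linarith [Real.pi_pos])
    have e2 := sin_sub_add_sin_le (β := θ₂ - θ₁) (t := θ - θ₁) (by linarith) h3
    rw [show θ₂ - θ₁ - (θ - θ₁) = θ₂ - θ by ring] at e2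
    have e3 : Real.sin (θ₂ - θ₁) * extent (unitVec θ) P ≤
        Real.sin (θ₂ - θ₁) * (Real.sqrt 2 * L) := by
      nlinarith [mul_le_mul_of_nonneg_left hL₁ hs1, mul_le_mul_of_nonneg_left hL₂ hs2,
        mul_le_mul_of_nonneg_right e2 hL]
    exact le_of_mul_le_mul_left e3 hs

/-- The shorter of the two arcs between two orientations of small width spans at most a right
angle, so that the width grows at most by the factor `√2` on it. -/
theorem isConnectedCost_STRIP (n : ℕ) {κ : ℝ} :
    IsConnectedCost (fun (P : Config n) (γ : AddCircle Real.pi) => STRIP n γ P.1) κ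
      (Real.sqrt 2 * κ) where
  continuous := by
    refine continuous_of_continuous_coe (F := fun (P : Config n) γ => STRIP n γ P.1) ?_
    simp only [STRIP_coe]
    exact continuous_extent_comp (by fun_prop) (by fun_prop)
  nonneg P γ := by
    obtain ⟨θ, rfl⟩ := exists_coe_eq γ
    rw [STRIP_coe]
    exact extent_nonneg _ _
  unique_zero P γ γ' h h' := by
    obtain ⟨θ, rfl⟩ := exists_coe_eq γ
    obtain ⟨θ', rfl⟩ := exists_coe_eq γ'
    rw [STRIP_coe] at h h'
    have h2 := P.coe_eq_coe_of_extent_eq_zero h h'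
    rwa [AddCircle.coe_add, AddCircle.coe_add, add_left_inj] at h2
  connected P θ₁ θ₂ _ h1 h2 hθ₁ hθ₂ := by
    simp only [STRIP_coe] at hθ₁ hθ₂ ⊢
    simp only [mul_assoc]
    rcases le_total (θ₂ - θ₁) (Real.pi / 2) with h | h
    · left
      intro θ hθ
      exact extent_le_sqrt_two_mul P.1 (by linarith [hθ.1]) (by linarith [hθ.2])
        (by linarith) hθ₁ hθ₂
    · right
      intro θ hθ
      refine extent_le_sqrt_two_mul P.1 (θ₁ := θ₂ + Real.pi / 2)
        (θ₂ := θ₁ + Real.pi / 2 + Real.pi) (by linarith [hθ.1]) (by linarith [hθ.2])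
        (by linarith) hθ₂ ?_
      rwa [extent_add_pi]

end Strip

section Box

theorem OBB_coe {n : ℕ} (θ : ℝ) (P : Fin n → Plane) :
    OBB n (θ : Orientation) P =
      extent (unitVec θ) P * extent (unitVec (θ + Real.pi / 2)) P := rfl

theorem OBB_periodic_pi_div_two {n : ℕ} (P : Fin n → Plane) :
    Function.Periodic
      (fun θ : ℝ => extent (unitVec θ) P * extent (unitVec (θ + Real.pi / 2)) P)
      (Real.pi / 2) := by
  intro θ
  have h : θ + Real.pi / 2 + Real.pi / 2 = θ + Real.pi := by ring
  simp only [h, extent_add_pi, mul_comm]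

/-- The area of the bounding box, on the circle of length `π / 2`: an orientation and its orthogonal
orientation have the same bounding box. -/
def boxCost {n : ℕ} (P : Config n) (γ : AddCircle (Real.pi / 2)) : ℝ :=
  (OBB_periodic_pi_div_two P.1).lift γ

theorem boxCost_coe {n : ℕ} (P : Config n) (θ : ℝ) :
    boxCost P θ = extent (unitVec θ) P.1 * extent (unitVec (θ + Real.pi / 2)) P.1 := rfl

theorem iInf_boxCost {n : ℕ} (P : Config n) : ⨅ γ, boxCost P γ = ⨅ γ, OBB n γ P.1 := by
  rw [← (QuotientAddGroup.mk_surjective (s := AddSubgroup.zmultiples (Real.pi / 2))).iInf_comp,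
    ← (QuotientAddGroup.mk_surjective (s := AddSubgroup.zmultiples Real.pi)).iInf_comp]
  rfl

theorem exists_zero_of_box_eq_zero {n : ℕ} {P : Fin n → Plane} {θ : ℝ}
    (h : extent (unitVec θ) P * extent (unitVec (θ + Real.pi / 2)) P = 0) :
    ∃ η : ℝ, extent (unitVec η) P = 0 ∧
      (η : AddCircle (Real.pi / 2)) = (θ : AddCircle (Real.pi / 2)) := by
  rcases mul_eq_zero.1 h with h | h
  · exact ⟨θ, h, rfl⟩
  · exact ⟨_, h, AddCircle.coe_add_period _ _⟩

theorem coe_pi_div_two_eq_of_coe_pi_eq {θ θ' : ℝ}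
    (h : (θ : AddCircle Real.pi) = (θ' : AddCircle Real.pi)) :
    (θ : AddCircle (Real.pi / 2)) = (θ' : AddCircle (Real.pi / 2)) := by
  rw [← sub_eq_zero, ← AddCircle.coe_sub, AddCircle.coe_eq_zero_iff] at h ⊢
  obtain ⟨k, hk⟩ := h
  refine ⟨2 * k, ?_⟩
  rw [← hk]
  simp
  ring

theorem box_le_of_sum_le {n : ℕ} (P : Fin n → Plane) {θ₁ θ₂ θ K δ : ℝ} (h1 : θ₁ ≤ θ) (h2 : θ ≤ θ₂)
    (hlt : θ₁ < θ₂) (h3 : θ₂ - θ₁ ≤ Real.pi / 2) (hδ : 0 ≤ δ)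
    (hK₁ : extent (unitVec θ₁) P * extent (unitVec (θ₁ + Real.pi / 2)) P ≤ K)
    (hK₂ : extent (unitVec θ₂) P * extent (unitVec (θ₂ + Real.pi / 2)) P ≤ K)
    (hE : extent (unitVec θ₁) P * extent (unitVec (θ₂ + Real.pi / 2)) P +
      extent (unitVec (θ₁ + Real.pi / 2)) P * extent (unitVec θ₂) P ≤
        K * ((1 + 5 * Real.cos (θ₂ - θ₁)) / 2 + 16 * δ)) :
    extent (unitVec θ) P * extent (unitVec (θ + Real.pi / 2)) P ≤ K * (5 / 4 + 8 * δ) := by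
  have hpi := Real.pi_pos
  have hs : 0 < Real.sin (θ₂ - θ₁) :=
    Real.sin_pos_of_pos_of_lt_pi (by linarith) (by linarith)
  have hs1 : 0 ≤ Real.sin (θ₂ - θ) :=
    Real.sin_nonneg_of_nonneg_of_le_pi (by linarith) (by linarith)
  have hs2 : 0 ≤ Real.sin (θ - θ₁) :=
    Real.sin_nonneg_of_nonneg_of_le_pi (by linarith) (by linarith)
  have hc : 0 ≤ Real.cos (θ₂ - θ₁) :=
    Real.cos_nonneg_of_neg_pi_div_two_le_of_le (by linarith) h3
  have hK : 0 ≤ K := (mul_nonneg (extent_nonneg _ _) (extent_nonneg _ _)).trans hK₁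
  have e1 := sin_mul_extent_le P h1 h2 (by linarith)
  have e2 := sin_mul_extent_le P (θ₁ := θ₁ + Real.pi / 2) (θ₂ := θ₂ + Real.pi / 2)
    (θ := θ + Real.pi / 2) (by linarith) (by linarith) (by linarith)
  simp only [add_sub_add_right_eq_sub] at e2
  have hid : Real.sin (θ₂ - θ) ^ 2 + Real.sin (θ - θ₁) ^ 2 +
      2 * Real.cos (θ₂ - θ₁) * (Real.sin (θ₂ - θ) * Real.sin (θ - θ₁)) =
        Real.sin (θ₂ - θ₁) ^ 2 := by
    rw [show θ₂ - θ₁ = (θ₂ - θ) + (θ - θ₁) by ring, Real.sin_add (θ₂ - θ), Real.cos_add (θ₂ - θ)]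
    linear_combination
      -(Real.sin (θ₂ - θ)) ^ 2 * Real.sin_sq_add_cos_sq (θ - θ₁)
      - (Real.sin (θ - θ₁)) ^ 2 * Real.sin_sq_add_cos_sq (θ₂ - θ)
  have e3 := box_product_le hc hs1 hs2 hid hδ hK hK₁ hK₂ hE
  have e4 := mul_le_mul e1 e2 (mul_nonneg hs.le (extent_nonneg _ _))
    (add_nonneg (mul_nonneg hs1 (extent_nonneg _ _)) (mul_nonneg hs2 (extent_nonneg _ _)))
  have e5 := e4.trans e3
  have hs3 : 0 < Real.sin (θ₂ - θ₁) ^ 2 := by positivity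
  refine le_of_mul_le_mul_right ?_ hs3
  linarith

/-- The bound `a ≤ c * C + d * S` multiplied by `b`, in units of `K`, where `a * b` is at least `m`
and `m` is about `K`. -/
theorem le_div_mul_add_div_mul {m K a b c d C S η : ℝ} (hK : 0 < K) (hb : 0 ≤ b)
    (hm : K * η ≤ m) (hab : m ≤ a * b) (h : a ≤ c * C + d * S) :
    η ≤ b * c / K * C + b * d / K * S := by
  have h1 : b * c / K * C + b * d / K * S = b * (c * C + d * S) / K := by ring
  rw [h1, le_div_iff₀ hK]
  nlinarith [mul_le_mul_of_nonneg_left h hb]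

/-- The extents of the bounding boxes of two orientations bound each other, and `sum_le_or_sum_le`
applies: on one of the two arcs between two orientations with nearly minimal boxes, all boxes have
area about `5 / 4` times the minimum or less. -/
theorem box_connected {n : ℕ} (P : Fin n → Plane) {θ₁ θ₂ m δ : ℝ} (hm : 0 < m) (hδ : 0 < δ)
    (hδ1 : δ ≤ 1 / 100)
    (hmin : ∀ θ, m ≤ extent (unitVec θ) P * extent (unitVec (θ + Real.pi / 2)) P)
    (h1 : θ₁ < θ₂) (h2 : θ₂ < θ₁ + Real.pi / 2)
    (hK₁ : extent (unitVec θ₁) P * extent (unitVec (θ₁ + Real.pi / 2)) P ≤ (1 + δ / 2) * m)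
    (hK₂ : extent (unitVec θ₂) P * extent (unitVec (θ₂ + Real.pi / 2)) P ≤ (1 + δ / 2) * m) :
    (∀ θ ∈ Icc θ₁ θ₂, extent (unitVec θ) P * extent (unitVec (θ + Real.pi / 2)) P ≤
      (1 + δ / 2) * m * (5 / 4 + 8 * δ)) ∨
    ∀ θ ∈ Icc θ₂ (θ₁ + Real.pi / 2),
      extent (unitVec θ) P * extent (unitVec (θ + Real.pi / 2)) P ≤
        (1 + δ / 2) * m * (5 / 4 + 8 * δ) := by
  have hpi := Real.pi_pos
  have e1 : extent (unitVec θ₁) P ≤ extent (unitVec θ₂) P * Real.cos (θ₂ - θ₁) +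
      extent (unitVec (θ₂ + Real.pi / 2)) P * Real.sin (θ₂ - θ₁) := by
    have h := sin_mul_extent_le P (θ₁ := θ₂ + Real.pi / 2) (θ := θ₁ + Real.pi)
      (θ₂ := θ₂ + Real.pi) (by linarith) (by linarith) (by linarith)
    rw [extent_add_pi, extent_add_pi, show θ₂ + Real.pi - (θ₂ + Real.pi / 2) = Real.pi / 2 by ring,
      show θ₂ + Real.pi - (θ₁ + Real.pi) = θ₂ - θ₁ by ring,
      show θ₁ + Real.pi - (θ₂ + Real.pi / 2) = Real.pi / 2 - (θ₂ - θ₁) by ring,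
      Real.sin_pi_div_two, Real.sin_pi_div_two_sub] at h
    linarith
  have e2 : extent (unitVec (θ₁ + Real.pi / 2)) P ≤
      extent (unitVec (θ₂ + Real.pi / 2)) P * Real.cos (θ₂ - θ₁) +
        extent (unitVec θ₂) P * Real.sin (θ₂ - θ₁) := by
    have h := sin_mul_extent_le P (θ₁ := θ₂) (θ := θ₁ + Real.pi / 2)
      (θ₂ := θ₂ + Real.pi / 2) (by linarith) (by linarith) (by linarith)
    rw [show θ₂ + Real.pi / 2 - θ₂ = Real.pi / 2 by ring,
      show θ₂ + Real.pi / 2 - (θ₁ + Real.pi / 2) = θ₂ - θ₁ by ring,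
      show θ₁ + Real.pi / 2 - θ₂ = Real.pi / 2 - (θ₂ - θ₁) by ring,
      Real.sin_pi_div_two, Real.sin_pi_div_two_sub] at h
    linarith
  have e3 : extent (unitVec θ₂) P ≤ extent (unitVec θ₁) P * Real.cos (θ₂ - θ₁) +
      extent (unitVec (θ₁ + Real.pi / 2)) P * Real.sin (θ₂ - θ₁) := by
    have h := sin_mul_extent_le P (θ₁ := θ₁) (θ := θ₂)
      (θ₂ := θ₁ + Real.pi / 2) (by linarith) (by linarith) (by linarith)
    rw [show θ₁ + Real.pi / 2 - θ₁ = Real.pi / 2 by ring,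
      show θ₁ + Real.pi / 2 - θ₂ = Real.pi / 2 - (θ₂ - θ₁) by ring,
      Real.sin_pi_div_two, Real.sin_pi_div_two_sub] at h
    linarith
  have e4 : extent (unitVec (θ₂ + Real.pi / 2)) P ≤
      extent (unitVec (θ₁ + Real.pi / 2)) P * Real.cos (θ₂ - θ₁) +
        extent (unitVec θ₁) P * Real.sin (θ₂ - θ₁) := by
    have h := sin_mul_extent_le P (θ₁ := θ₁ + Real.pi / 2) (θ := θ₂ + Real.pi / 2)
      (θ₂ := θ₁ + Real.pi) (by linarith) (by linarith) (by linarith)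
    rw [extent_add_pi, show θ₁ + Real.pi - (θ₁ + Real.pi / 2) = Real.pi / 2 by ring,
      show θ₁ + Real.pi - (θ₂ + Real.pi / 2) = Real.pi / 2 - (θ₂ - θ₁) by ring,
      show θ₂ + Real.pi / 2 - (θ₁ + Real.pi / 2) = θ₂ - θ₁ by ring,
      Real.sin_pi_div_two, Real.sin_pi_div_two_sub] at h
    linarith
  have harc₁ := fun θ (hθ : θ ∈ Icc θ₁ θ₂) => box_le_of_sum_le P hθ.1 hθ.2 h1 (by linarith) hδ.le
    hK₁ hK₂
  have hK₃ : extent (unitVec (θ₁ + Real.pi / 2)) P *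
      extent (unitVec (θ₁ + Real.pi / 2 + Real.pi / 2)) P ≤ (1 + δ / 2) * m := by
    rwa [add_assoc, add_halves, extent_add_pi, mul_comm]
  have harc₂ := fun θ (hθ : θ ∈ Icc θ₂ (θ₁ + Real.pi / 2)) =>
    box_le_of_sum_le P hθ.1 hθ.2 h2 (by linarith) hδ.le hK₂ hK₃
  rw [show θ₁ + Real.pi / 2 - θ₂ = Real.pi / 2 - (θ₂ - θ₁) by ring, Real.cos_pi_div_two_sub,
    show θ₁ + Real.pi / 2 + Real.pi / 2 = θ₁ + Real.pi by ring, extent_add_pi] at harc₂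
  have hm₁ := hmin θ₁
  have hm₂ := hmin θ₂
  have ha0 := extent_nonneg (unitVec θ₁) P
  have hb0 := extent_nonneg (unitVec (θ₁ + Real.pi / 2)) P
  have hc0 := extent_nonneg (unitVec θ₂) P
  have hd0 := extent_nonneg (unitVec (θ₂ + Real.pi / 2)) P
  have hcos : 0 ≤ Real.cos (θ₂ - θ₁) :=
    Real.cos_nonneg_of_neg_pi_div_two_le_of_le (by linarith) (by linarith)
  have hsin : 0 ≤ Real.sin (θ₂ - θ₁) :=
    Real.sin_nonneg_of_nonneg_of_le_pi (by linarith) (by linarith)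
  have hsq : Real.cos (θ₂ - θ₁) ^ 2 + Real.sin (θ₂ - θ₁) ^ 2 = 1 := Real.cos_sq_add_sin_sq _
  generalize Real.cos (θ₂ - θ₁) = C at *
  generalize Real.sin (θ₂ - θ₁) = S at *
  generalize extent (unitVec θ₁) P = a at *
  generalize extent (unitVec (θ₁ + Real.pi / 2)) P = b at *
  generalize extent (unitVec θ₂) P = c at *
  generalize extent (unitVec (θ₂ + Real.pi / 2)) P = d at *
  set K := (1 + δ / 2) * m with hKdef
  have hK : 0 < K := by positivity
  have hKm : K * (1 - δ / 2) ≤ m := by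
    rw [hKdef]
    nlinarith [mul_nonneg hm.le (sq_nonneg δ)]
  have ha : 0 < a := ha0.lt_of_ne' fun h => by rw [h, zero_mul] at hm₁; linarith
  have hb : 0 < b := hb0.lt_of_ne' fun h => by rw [h, mul_zero] at hm₁; linarith
  have hc : 0 < c := hc0.lt_of_ne' fun h => by rw [h, zero_mul] at hm₂; linarith
  have hd : 0 < d := hd0.lt_of_ne' fun h => by rw [h, mul_zero] at hm₂; linarith
  have hprod : (a * b) * (c * d) ≤ K * K := mul_le_mul hK₁ hK₂ (by positivity) hK.le
  have f1 := le_div_mul_add_div_mul hK hb0 hKm hm₁ e1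
  have f2 := le_div_mul_add_div_mul hK ha0 hKm (by rwa [mul_comm]) e2
  have f3 := le_div_mul_add_div_mul hK hd0 hKm hm₂ e3
  have f4 := le_div_mul_add_div_mul hK hc0 hKm (by rwa [mul_comm]) e4
  rcases sum_le_or_sum_le (x := a * d / K) (y := b * c / K) (X := a * c / K) (Y := b * d / K) hsq
    hcos hsin (by positivity) (by positivity) (by positivity) (by positivity)
    (by rw [div_mul_div_comm, div_le_one (by positivity)]; linarith)
    (by rw [div_mul_div_comm, div_le_one (by positivity)]; linarith) hδ hδ1
    f2 (by rwa [mul_comm d a, mul_comm d b] at f3) (by rwa [mul_comm c b, mul_comm c a] at f4) f1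
    with h | h
  · left
    rw [← add_div, div_le_iff₀' hK] at h
    exact fun θ hθ => harc₁ θ hθ h
  · right
    rw [← add_div, div_le_iff₀' hK] at h
    exact fun θ hθ => harc₂ θ hθ (by linarith)

theorem isConnectedCost_boxCost (n : ℕ) {δ : ℝ} (hδ : 0 < δ) (hδ1 : δ ≤ 1 / 100) :
    IsConnectedCost (boxCost (n := n)) (1 + δ / 2) ((1 + δ / 2) * (5 / 4 + 8 * δ)) where
  continuous := by
    refine continuous_of_continuous_coe ?_
    simp only [boxCost_coe]
    exact (continuous_extent_comp (by fun_prop) (by fun_prop)).mul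
      (continuous_extent_comp (by fun_prop) (by fun_prop))
  nonneg P γ := by
    obtain ⟨θ, rfl⟩ := exists_coe_eq γ
    rw [boxCost_coe]
    exact mul_nonneg (extent_nonneg _ _) (extent_nonneg _ _)
  unique_zero P γ γ' h h' := by
    obtain ⟨θ, rfl⟩ := exists_coe_eq γ
    obtain ⟨θ', rfl⟩ := exists_coe_eq γ'
    rw [boxCost_coe] at h h'
    obtain ⟨η, hη, hηθ⟩ := exists_zero_of_box_eq_zero h
    obtain ⟨η', hη', hηθ'⟩ := exists_zero_of_box_eq_zero h'
    rw [← hηθ, ← hηθ']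
    exact coe_pi_div_two_eq_of_coe_pi_eq (P.coe_eq_coe_of_extent_eq_zero hη hη')
  connected P θ₁ θ₂ hm h1 h2 hθ₁ hθ₂ := by
    have hbdd : BddBelow (range (boxCost P)) := by
      refine ⟨0, ?_⟩
      rintro _ ⟨γ, rfl⟩
      obtain ⟨θ, rfl⟩ := exists_coe_eq γ
      rw [boxCost_coe]
      exact mul_nonneg (extent_nonneg _ _) (extent_nonneg _ _)
    have hmin : ∀ θ : ℝ, (⨅ γ, boxCost P γ) ≤ boxCost P θ := fun θ => ciInf_le hbdd _
    have hle : (1 + δ / 2) * (⨅ γ, boxCost P γ) ≤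
        (1 + δ / 2) * (5 / 4 + 8 * δ) * ⨅ γ, boxCost P γ := by
      have h3 : 0 ≤ (1 + δ / 2) * (⨅ γ, boxCost P γ) := by positivity
      nlinarith
    rcases h1.eq_or_lt with rfl | h1
    · left
      intro θ hθ
      obtain rfl : θ = θ₁ := le_antisymm hθ.2 hθ.1
      exact hθ₁.trans hle
    rcases h2.eq_or_lt with rfl | h2
    · right
      intro θ hθ
      obtain rfl : θ = θ₁ + Real.pi / 2 := le_antisymm hθ.2 hθ.1
      exact hθ₂.trans hle
    simp only [boxCost_coe] at hmin hθ₁ hθ₂ ⊢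
    have h3 : (1 + δ / 2) * (5 / 4 + 8 * δ) * (⨅ γ, boxCost P γ) =
        (1 + δ / 2) * (⨅ γ, boxCost P γ) * (5 / 4 + 8 * δ) := by ring
    rw [h3]
    exact box_connected P.1 hm hδ hδ1 hmin h1 h2 hθ₁ hθ₂

end Box

/-! ### Principal components -/

section PrincipalComponent

variable {n : ℕ}

theorem norm_unitVec (θ : ℝ) : ‖unitVec θ‖ = 1 := by
  have h : ‖unitVec θ‖ ^ 2 = 1 := by
    rw [← real_inner_self_eq_norm_sq, inner_unitVec]
    simp only [unitVec, PiLp.toLp_apply, Matrix.cons_val_zero, Matrix.cons_val_one]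
    nlinarith [Real.sin_sq_add_cos_sq θ]
  nlinarith [norm_nonneg (unitVec θ)]

theorem eq_inner_smul_add_inner_smul (x : Plane) (θ : ℝ) :
    x = inner ℝ x (unitVec θ) • unitVec θ +
      inner ℝ x (unitVec (θ + Real.pi / 2)) • unitVec (θ + Real.pi / 2) := by
  simp only [inner_unitVec, Real.cos_add_pi_div_two, Real.sin_add_pi_div_two]
  ext i
  fin_cases i
  · simp [unitVec, Real.cos_add_pi_div_two, Real.sin_add_pi_div_two]
    linear_combination -x 0 * Real.sin_sq_add_cos_sq θ
  · simp [unitVec, Real.cos_add_pi_div_two, Real.sin_add_pi_div_two]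
    linear_combination -x 1 * Real.sin_sq_add_cos_sq θ

theorem inner_unitVec_add_pi_div_two (θ : ℝ) :
    inner ℝ (unitVec θ) (unitVec (θ + Real.pi / 2)) = 0 := by
  rw [inner_unitVec, Real.cos_add_pi_div_two, Real.sin_add_pi_div_two]
  simp [unitVec]
  ring

theorem infDist_of_mem_linesAlong {θ : ℝ} {L : AffineSubspace ℝ Plane}
    (hL : L ∈ linesAlong (unitVec θ)) {q : Plane} (hq : q ∈ L) (x : Plane) :
    Metric.infDist x (L : Set Plane) = |inner ℝ (x - q) (unitVec (θ + Real.pi / 2))| := by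
  refine le_antisymm ?_ ?_
  · have hmem : inner ℝ (x - q) (unitVec θ) • unitVec θ +ᵥ q ∈ L := by
      refine AffineSubspace.vadd_mem_of_mem_direction ?_ hq
      rw [hL.2]
      exact Submodule.smul_mem _ _ (Submodule.mem_span_singleton_self _)
    refine (Metric.infDist_le_dist_of_mem hmem).trans (le_of_eq ?_)
    have h := eq_inner_smul_add_inner_smul (x - q) θ
    rw [dist_eq_norm, vadd_eq_add]
    have h2 : x - (inner ℝ (x - q) (unitVec θ) • unitVec θ + q) =
        inner ℝ (x - q) (unitVec (θ + Real.pi / 2)) • unitVec (θ + Real.pi / 2) := by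
      rw [add_comm, ← sub_sub, sub_eq_iff_eq_add']
      exact h
    rw [h2, norm_smul, norm_unitVec, mul_one, Real.norm_eq_abs]
  · refine (Metric.le_infDist hL.1).2 fun y hy => ?_
    have hdir : y - q ∈ L.direction := AffineSubspace.vsub_mem_direction hy hq
    rw [hL.2, Submodule.mem_span_singleton] at hdir
    obtain ⟨r, hr⟩ := hdir
    have h0 : inner ℝ (y - q) (unitVec (θ + Real.pi / 2)) = 0 := by
      rw [← hr, real_inner_smul_left, inner_unitVec_add_pi_div_two, mul_zero]
    have h1 : x - q = (x - y) + (y - q) := by abel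
    rw [h1, inner_add_left, h0, add_zero, dist_eq_norm]
    refine (abs_real_inner_le_norm _ _).trans ?_
    rw [norm_unitVec, mul_one]

/-- The sum of squared deviations of reals from any point is at least that from their mean. -/
theorem sum_sq_sub_mean_le (z : Fin n → ℝ) (s : ℝ) :
    ∑ i, (z i - (∑ j, z j) / n) ^ 2 ≤ ∑ i, (z i - s) ^ 2 := by
  rcases n.eq_zero_or_pos with rfl | hn
  · simp
  set μ := (∑ j, z j) / n with hμ
  have h0 : ∑ i, (z i - μ) = 0 := by
    rw [Finset.sum_sub_distrib, Finset.sum_const, Finset.card_univ, Fintype.card_fin, nsmul_eq_mul,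
      hμ]
    field_simp
    ring
  have h1 : ∑ i, (z i - s) ^ 2 =
      ∑ i, (z i - μ) ^ 2 + 2 * (μ - s) * ∑ i, (z i - μ) + ∑ _i : Fin n, (μ - s) ^ 2 := by
    rw [Finset.mul_sum, ← Finset.sum_add_distrib, ← Finset.sum_add_distrib]
    exact Finset.sum_congr rfl fun i _ => by ring
  rw [h1, h0, mul_zero, add_zero]
  exact le_add_of_nonneg_right (Finset.sum_nonneg fun _ _ => sq_nonneg _)

/-- The coordinates of the points relative to their centroid. -/
def centered (P : Fin n → Plane) (i : Fin n) (k : Fin 2) : ℝ := P i k - (∑ j, P j k) / n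

theorem minSqDist_unitVec (P : Fin n → Plane) (θ : ℝ) :
    minSqDist (unitVec θ) P =
      ∑ i, (centered P i 1 * Real.cos θ - centered P i 0 * Real.sin θ) ^ 2 := by
  set z : Fin n → ℝ := fun i => inner ℝ (P i) (unitVec (θ + Real.pi / 2)) with hz
  have hz' : ∀ i, z i = P i 1 * Real.cos θ - P i 0 * Real.sin θ := fun i => by
    simp only [hz, inner_unitVec, Real.cos_add_pi_div_two, Real.sin_add_pi_div_two]
    ring
  have hmean : (∑ j, z j) / n = (∑ j, P j 1) / n * Real.cos θ - (∑ j, P j 0) / n * Real.sin θ := by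
    simp only [hz', Finset.sum_sub_distrib, ← Finset.sum_mul]
    ring
  have hsum : ∑ i, (centered P i 1 * Real.cos θ - centered P i 0 * Real.sin θ) ^ 2 =
      ∑ i, (z i - (∑ j, z j) / n) ^ 2 := by
    refine Finset.sum_congr rfl fun i _ => ?_
    rw [hmean, hz', centered, centered]
    ring
  have hterm : ∀ L : linesAlong (unitVec θ), ∀ q ∈ (L : AffineSubspace ℝ Plane),
      ∑ i, Metric.infDist (P i) ((L : AffineSubspace ℝ Plane) : Set Plane) ^ 2 =
        ∑ i, (z i - inner ℝ q (unitVec (θ + Real.pi / 2))) ^ 2 := fun L q hq =>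
    Finset.sum_congr rfl fun i _ => by
      rw [infDist_of_mem_linesAlong L.2 hq, sq_abs, inner_sub_left]
  rw [hsum, minSqDist]
  -- the line through the centroid
  set q : Plane := !₂[(∑ j, P j 0) / n, (∑ j, P j 1) / n] with hq
  let L₀ : linesAlong (unitVec θ) :=
    ⟨AffineSubspace.mk' q (Submodule.span ℝ {unitVec θ}),
      ⟨q, AffineSubspace.self_mem_mk' _ _⟩, AffineSubspace.direction_mk' _ _⟩
  have hqz : inner ℝ q (unitVec (θ + Real.pi / 2)) = (∑ j, z j) / n := by
    rw [hmean, inner_unitVec, Real.cos_add_pi_div_two, Real.sin_add_pi_div_two]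
    simp only [hq, PiLp.toLp_apply, Matrix.cons_val_zero, Matrix.cons_val_one]
    ring
  refine le_antisymm ?_ ?_
  · refine (ciInf_le ⟨0, ?_⟩ L₀).trans (le_of_eq ?_)
    · rintro _ ⟨L, rfl⟩
      exact Finset.sum_nonneg fun _ _ => sq_nonneg _
    · rw [hterm L₀ q (AffineSubspace.self_mem_mk' _ _), hqz]
  · have : Nonempty (linesAlong (unitVec θ)) := ⟨L₀⟩
    refine le_ciInf fun L => ?_
    obtain ⟨q', hq'⟩ := L.2.1
    rw [hterm L q' hq']
    exact sum_sq_sub_mean_le z _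

theorem PC_coe (θ : ℝ) (P : Fin n → Plane) :
    PC n (θ : Orientation) P =
      ∑ i, (centered P i 1 * Real.cos θ - centered P i 0 * Real.sin θ) ^ 2 :=
  minSqDist_unitVec P θ

/-- A quadratic form that is nonpositive at two vectors, and whose polar form is nonpositive on
them, is nonpositive on the cone that they span. -/
theorem quadratic_nonpos_of_arc {a b d θ₁ θ₂ θ : ℝ} (h1 : θ₁ ≤ θ) (h2 : θ ≤ θ₂) (hlt : θ₁ < θ₂)
    (hlt' : θ₂ < θ₁ + Real.pi)
    (hq₁ : a * Real.cos θ₁ ^ 2 + 2 * b * (Real.cos θ₁ * Real.sin θ₁) + d * Real.sin θ₁ ^ 2 ≤ 0)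
    (hq₂ : a * Real.cos θ₂ ^ 2 + 2 * b * (Real.cos θ₂ * Real.sin θ₂) + d * Real.sin θ₂ ^ 2 ≤ 0)
    (hb : a * (Real.cos θ₁ * Real.cos θ₂) +
      b * (Real.cos θ₁ * Real.sin θ₂ + Real.sin θ₁ * Real.cos θ₂) +
      d * (Real.sin θ₁ * Real.sin θ₂) ≤ 0) :
    a * Real.cos θ ^ 2 + 2 * b * (Real.cos θ * Real.sin θ) + d * Real.sin θ ^ 2 ≤ 0 := by
  have hs1 : 0 ≤ Real.sin (θ₂ - θ) :=
    Real.sin_nonneg_of_nonneg_of_le_pi (by linarith) (by linarith)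
  have hs2 : 0 ≤ Real.sin (θ - θ₁) :=
    Real.sin_nonneg_of_nonneg_of_le_pi (by linarith) (by linarith)
  have hs : 0 < Real.sin (θ₂ - θ₁) :=
    Real.sin_pos_of_pos_of_lt_pi (by linarith) (by linarith)
  have key : Real.sin (θ₂ - θ₁) ^ 2 *
      (a * Real.cos θ ^ 2 + 2 * b * (Real.cos θ * Real.sin θ) + d * Real.sin θ ^ 2) =
      Real.sin (θ₂ - θ) ^ 2 *
        (a * Real.cos θ₁ ^ 2 + 2 * b * (Real.cos θ₁ * Real.sin θ₁) + d * Real.sin θ₁ ^ 2) +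
      Real.sin (θ - θ₁) ^ 2 *
        (a * Real.cos θ₂ ^ 2 + 2 * b * (Real.cos θ₂ * Real.sin θ₂) + d * Real.sin θ₂ ^ 2) +
      2 * (Real.sin (θ₂ - θ) * Real.sin (θ - θ₁)) * (a * (Real.cos θ₁ * Real.cos θ₂) +
        b * (Real.cos θ₁ * Real.sin θ₂ + Real.sin θ₁ * Real.cos θ₂) +
        d * (Real.sin θ₁ * Real.sin θ₂)) := by
    have hc : Real.sin (θ₂ - θ₁) * Real.cos θ =
        Real.sin (θ₂ - θ) * Real.cos θ₁ + Real.sin (θ - θ₁) * Real.cos θ₂ := by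
      simp only [Real.sin_sub]; ring
    have hsn : Real.sin (θ₂ - θ₁) * Real.sin θ =
        Real.sin (θ₂ - θ) * Real.sin θ₁ + Real.sin (θ - θ₁) * Real.sin θ₂ := by
      simp only [Real.sin_sub]; ring
    calc _ = a * (Real.sin (θ₂ - θ₁) * Real.cos θ) ^ 2 +
          2 * b * ((Real.sin (θ₂ - θ₁) * Real.cos θ) * (Real.sin (θ₂ - θ₁) * Real.sin θ)) +
          d * (Real.sin (θ₂ - θ₁) * Real.sin θ) ^ 2 := by ring
      _ = _ := by rw [hc, hsn]; ring
  have hle : Real.sin (θ₂ - θ₁) ^ 2 *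
      (a * Real.cos θ ^ 2 + 2 * b * (Real.cos θ * Real.sin θ) + d * Real.sin θ ^ 2) ≤ 0 := by
    rw [key]
    have t1 := mul_nonpos_of_nonneg_of_nonpos (sq_nonneg (Real.sin (θ₂ - θ))) hq₁
    have t2 := mul_nonpos_of_nonneg_of_nonpos (sq_nonneg (Real.sin (θ - θ₁))) hq₂
    have t3 := mul_nonpos_of_nonneg_of_nonpos
      (mul_nonneg zero_le_two (mul_nonneg hs1 hs2)) hb
    linarith
  by_contra hpos
  exact absurd (mul_pos (pow_pos hs 2) (not_le.1 hpos)) (not_lt.2 hle)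

theorem PC_coe_sub (θ L : ℝ) (P : Fin n → Plane) :
    PC n (θ : Orientation) P - L =
      (∑ i, centered P i 1 ^ 2 - L) * Real.cos θ ^ 2 +
        2 * (-∑ i, centered P i 0 * centered P i 1) * (Real.cos θ * Real.sin θ) +
        (∑ i, centered P i 0 ^ 2 - L) * Real.sin θ ^ 2 := by
  have h : PC n (θ : Orientation) P =
      (∑ i, centered P i 1 ^ 2) * Real.cos θ ^ 2 -
        2 * (∑ i, centered P i 0 * centered P i 1) * (Real.cos θ * Real.sin θ) +
        (∑ i, centered P i 0 ^ 2) * Real.sin θ ^ 2 := by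
    rw [PC_coe, mul_assoc 2, Finset.sum_mul, Finset.sum_mul, Finset.sum_mul, Finset.mul_sum,
      ← Finset.sum_sub_distrib, ← Finset.sum_add_distrib]
    exact Finset.sum_congr rfl fun i _ => by ring
  rw [h]
  linear_combination L * Real.sin_sq_add_cos_sq θ

/-- Orientations of cost at most `L` form an arc, since the cost is a quadratic form of the
direction. -/
theorem PC_connected (P : Fin n → Plane) {θ₁ θ₂ L : ℝ} (h1 : θ₁ ≤ θ₂) (h2 : θ₂ ≤ θ₁ + Real.pi)
    (hθ₁ : PC n (θ₁ : Orientation) P ≤ L) (hθ₂ : PC n (θ₂ : Orientation) P ≤ L) :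
    (∀ θ ∈ Icc θ₁ θ₂, PC n ((θ : ℝ) : Orientation) P ≤ L) ∨
      ∀ θ ∈ Icc θ₂ (θ₁ + Real.pi), PC n ((θ : ℝ) : Orientation) P ≤ L := by
  rcases h1.eq_or_lt with rfl | h1
  · left
    intro θ hθ
    obtain rfl : θ = θ₁ := le_antisymm hθ.2 hθ.1
    exact hθ₁
  rcases h2.eq_or_lt with rfl | h2
  · right
    intro θ hθ
    obtain rfl : θ = θ₁ + Real.pi := le_antisymm hθ.2 hθ.1
    exact hθ₂
  rw [← sub_nonpos, PC_coe_sub] at hθ₁ hθ₂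
  rcases le_total ((∑ i, centered P i 1 ^ 2 - L) * (Real.cos θ₁ * Real.cos θ₂) +
      (-∑ i, centered P i 0 * centered P i 1) *
        (Real.cos θ₁ * Real.sin θ₂ + Real.sin θ₁ * Real.cos θ₂) +
      (∑ i, centered P i 0 ^ 2 - L) * (Real.sin θ₁ * Real.sin θ₂)) 0 with hb | hb
  · left
    intro θ hθ
    rw [← sub_nonpos, PC_coe_sub]
    exact quadratic_nonpos_of_arc hθ.1 hθ.2 h1 h2 hθ₁ hθ₂ hb
  · right
    intro θ hθ
    rw [← sub_nonpos, PC_coe_sub]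
    refine quadratic_nonpos_of_arc hθ.1 hθ.2 h2 (by linarith) hθ₂ ?_ ?_
    · rw [Real.cos_add_pi, Real.sin_add_pi]
      linarith
    · rw [Real.cos_add_pi, Real.sin_add_pi]
      linarith

theorem isConnectedCost_PC (n : ℕ) {κ : ℝ} :
    IsConnectedCost (fun (P : Config n) (γ : AddCircle Real.pi) => PC n γ P.1) κ κ where
  continuous := by
    refine continuous_of_continuous_coe (F := fun (P : Config n) γ => PC n γ P.1) ?_
    have h1 : Continuous fun q : (Fin n → Plane) × ℝ => PC n (q.2 : ℝ) q.1 := by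
      simp only [PC_coe, centered]
      fun_prop
    have h2 := h1.comp ((continuous_subtype_val.comp continuous_fst).prodMk continuous_snd :
      Continuous fun q : Config n × ℝ => (q.1.1, q.2))
    exact h2
  nonneg P γ := by
    obtain ⟨θ, rfl⟩ := exists_coe_eq γ
    rw [PC_coe]
    exact Finset.sum_nonneg fun _ _ => sq_nonneg _
  unique_zero P γ γ' h h' := by
    obtain ⟨θ, rfl⟩ := exists_coe_eq γ
    obtain ⟨θ', rfl⟩ := exists_coe_eq γ'
    obtain ⟨P, i, j, hij⟩ := P
    have key : ∀ {η : ℝ}, PC n (η : Orientation) P = 0 →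
        inner ℝ (P i - P j) (unitVec (η + Real.pi / 2)) = 0 := by
      intro η hη
      rw [PC_coe, Finset.sum_eq_zero_iff_of_nonneg fun _ _ => sq_nonneg _] at hη
      have hi := pow_eq_zero_iff two_ne_zero |>.1 (hη i (Finset.mem_univ i))
      have hj := pow_eq_zero_iff two_ne_zero |>.1 (hη j (Finset.mem_univ j))
      rw [inner_unitVec, Real.cos_add_pi_div_two, Real.sin_add_pi_div_two]
      simp only [centered] at hi hj
      simp only [PiLp.sub_apply]
      linear_combination hi - hj
    refine coe_eq_coe_of_sin_sub_eq_zero ?_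
    rw [← add_sub_add_right_eq_sub θ' θ (Real.pi / 2)]
    exact sin_eq_zero_of_inner_unitVec (sub_ne_zero.2 hij) (key h) (key h')
  connected P θ₁ θ₂ _ h1 h2 hθ₁ hθ₂ := PC_connected P.1 h1 h2 hθ₁ hθ₂

end PrincipalComponent

/-! ### State-aware algorithms and upper bounds -/

theorem costRatio_le {cost opt ρ : ℝ} (hopt : 0 ≤ opt) (hρ : 1 ≤ ρ) (hcost : 0 ≤ cost)
    (h : cost ≤ ρ * opt) : costRatio cost opt ≤ ENNReal.ofReal ρ := by
  unfold costRatio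
  split_ifs with h0
  · simpa using hρ
  · have hpos : 0 < opt := by
      refine hopt.lt_of_ne fun h1 => h0 ⟨h1.symm, le_antisymm ?_ hcost⟩
      rwa [← h1, mul_zero] at h
    rw [← ENNReal.ofReal_div_of_pos hpos]
    exact ENNReal.ofReal_le_ofReal ((div_le_iff₀ hpos).2 h)

theorem le_costRatio {cost opt ρ : ℝ} (hopt : 0 ≤ opt) (hcost : 0 < cost) (h : ρ * opt ≤ cost) :
    ENNReal.ofReal ρ ≤ costRatio cost opt := by
  rw [costRatio, if_neg fun h0 => hcost.ne' h0.2]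
  rcases hopt.eq_or_lt with rfl | hpos
  · rw [ENNReal.ofReal_zero, ENNReal.div_zero (by simpa using hcost)]
    exact le_top
  · rw [← ENNReal.ofReal_div_of_pos hpos]
    exact ENNReal.ofReal_le_ofReal ((le_div_iff₀ hpos).2 h)

section Algorithm

variable {n : ℕ} {T : ℝ}

/-- The path of configurations of a moving point set, extended to all times by keeping the initial
positions before `0` and the final ones after `T`. -/
def MovingPoints.path (hT : 0 ≤ T) (P : MovingPoints n T) (u : ℝ) : Config n :=
  ⟨P.pos (projIcc 0 T hT u), P.not_all_equal _⟩

theorem MovingPoints.continuous_path (hT : 0 ≤ T) (P : MovingPoints n T) :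
    Continuous (P.path hT) := by
  refine Continuous.subtype_mk ?_ _
  exact (continuous_pi P.continuous_pos).comp continuous_projIcc

theorem MovingPoints.path_coe (hT : 0 ≤ T) (P : MovingPoints n T) (t : Icc (0 : ℝ) T) :
    (P.path hT t).1 = P.pos t := by
  simp [MovingPoints.path]

theorem MovingPoints.path_congr (hT : 0 ≤ T) {P Q : MovingPoints n T} {u : ℝ}
    (h : P.pos (projIcc 0 T hT u) = Q.pos (projIcc 0 T hT u)) : P.path hT u = Q.path hT u :=
  Subtype.ext h

/-- A causal functional gives a state-aware algorithm: the state is the current time together with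
the past of the path, continued by the current position. -/
def causalAlgorithm (n : ℕ) (hT : 0 ≤ T) (out : (ℝ → Config n) → ℝ → ℝ) :
    StateAwareAlgorithm n T where
  State := ℝ × (ℝ → Config n)
  state P t := (t, fun u => P.path hT (min u t))
  state_init P Q t ht h := by
    refine Prod.ext rfl (funext fun u => P.path_congr hT ?_)
    have h0 : projIcc 0 T hT (min u t) = t := by
      rw [projIcc_of_le_left hT (by rw [ht]; exact min_le_right _ _)]
      exact Subtype.ext ht.symm
    rw [h0, h]
  state_step P Q s t hst h hpos := by
    refine Prod.ext rfl (funext fun u => ?_)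
    rcases le_total u s with hu | hu
    · have h1 : min u (t : ℝ) = min u s := by
        rw [min_eq_left hu, min_eq_left (hu.trans hst)]
      simp only [h1]
      exact congrFun (congrArg Prod.snd h) u
    · have hmem : min u (t : ℝ) ∈ Icc (s : ℝ) t := ⟨le_min hu hst, min_le_right _ _⟩
      have hmem' : min u (t : ℝ) ∈ Icc (0 : ℝ) T := ⟨s.2.1.trans hmem.1, hmem.2.trans t.2.2⟩
      refine P.path_congr hT ?_
      rw [projIcc_of_mem hT hmem']
      exact hpos _ hmem.1 hmem.2
  compute _ σ := (out σ.2 σ.1 : ℝ)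

theorem output_causalAlgorithm (hT : 0 ≤ T) {out : (ℝ → Config n) → ℝ → ℝ}
    (hcausal : ∀ c c' t, (∀ u ∈ Icc 0 t, c u = c' u) → 0 ≤ t → out c t = out c' t)
    (P : MovingPoints n T) (t : Icc (0 : ℝ) T) :
    (causalAlgorithm n hT out).output P t = (out (P.path hT) t : ℝ) := by
  have h : out (fun u => P.path hT (min u t)) t = out (P.path hT) t :=
    hcausal _ _ _ (fun u hu => by rw [min_eq_left hu.2]) t.2.1
  exact congrArg _ h

theorem isContinuous_causalAlgorithm (hT : 0 ≤ T) {out : (ℝ → Config n) → ℝ → ℝ}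
    (hcausal : ∀ c c' t, (∀ u ∈ Icc 0 t, c u = c' u) → 0 ≤ t → out c t = out c' t)
    (hcont : ∀ c, Continuous c → ContinuousOn (out c) (Ici 0)) :
    (causalAlgorithm n hT out).IsContinuous := by
  intro P
  have h : (causalAlgorithm n hT out).output P =
      fun t : Icc (0 : ℝ) T => ((out (P.path hT) t : ℝ) : Orientation) :=
    funext fun t => output_causalAlgorithm hT hcausal P t
  rw [h]
  exact (AddCircle.continuous_mk' _).comp
    ((hcont _ (P.continuous_path hT)).comp_continuous continuous_subtype_val fun t => t.2.1)

end Algorithm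

/-- For every number of points and every ratio above `ρ` there is a continuous state-aware
algorithm that achieves this ratio. -/
def IsAchievable (D : ShapeDescriptor) (ρ : ℝ) : Prop :=
  ∀ (n : ℕ) (T : ℝ), 0 < T → ∀ ρ' > ρ,
    ∃ A : StateAwareAlgorithm n T, A.IsContinuous ∧ worstRatio D A ≤ ENNReal.ofReal ρ'

theorem IsAchievable.topStabilityRatioOf_le {D : ShapeDescriptor} {ρ : ℝ} (h : IsAchievable D ρ)
    {T : ℝ} (hT : 0 < T) (n : ℕ) : topStabilityRatioOf D n T ≤ ENNReal.ofReal ρ := by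
  refine ENNReal.le_of_forall_pos_le_add fun ε hε _ => ?_
  obtain ⟨A, hA, hle⟩ := h n T hT (ρ + ε) (lt_add_of_pos_right _ hε)
  refine (iInf₂_le A hA).trans (hle.trans ?_)
  exact ENNReal.ofReal_add_le.trans (by simp)

theorem IsAchievable.topStabilityRatio_le {D : ShapeDescriptor} {ρ : ℝ} (h : IsAchievable D ρ)
    {T : ℝ} (hT : 0 < T) : topStabilityRatio D T ≤ ENNReal.ofReal ρ := by
  refine ENNReal.le_of_forall_pos_le_add fun ε hε _ => ?_
  choose A hA hle using fun n => h n T hT (ρ + ε) (lt_add_of_pos_right _ hε)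
  refine (iInf₂_le A hA).trans ((iSup_le hle).trans ?_)
  exact ENNReal.ofReal_add_le.trans (by simp)

/-- If the cost of a descriptor is a connected cost on a circle of some length `p`, then its causal
approximation gives an algorithm; lifted to the reals, the output also makes sense modulo `π`. -/
theorem exists_algorithm_of_isConnectedCost {D : ShapeDescriptor} {n : ℕ} {T : ℝ} (hT : 0 < T)
    {p κ ρ ρ' : ℝ} [Fact (0 < p)] {F : Config n → AddCircle p → ℝ} (hF : IsConnectedCost F κ ρ)
    (hκ : 1 < κ) (hρ : 1 ≤ ρ) (hρ' : ρ < ρ')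
    (hD : ∀ (P : Config n) (θ : ℝ), D n (θ : Orientation) P.1 = F P θ)
    (hinf : ∀ P : Config n, ⨅ γ, D n γ P.1 = ⨅ γ, F P γ) :
    ∃ A : StateAwareAlgorithm n T, A.IsContinuous ∧ worstRatio D A ≤ ENNReal.ofReal ρ' := by
  obtain ⟨out, hcont, hcausal, hle⟩ := hF.exists_causal_approx hκ (by linarith) hρ'
  refine ⟨causalAlgorithm n hT.le out, isContinuous_causalAlgorithm hT.le hcausal hcont,
    iSup₂_le fun P t => ?_⟩
  have h1 := hle _ t (P.continuous_path hT.le) t.2.1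
  rw [output_causalAlgorithm hT.le hcausal, approxRatio, ← P.path_coe hT.le t, hinf, hD]
  exact costRatio_le (hF.iInf_nonneg _) (by linarith) (hF.nonneg _ _) h1

theorem isAchievable_PC : IsAchievable PC 1 := by
  intro n T hT ρ' hρ'
  obtain ⟨κ, h1, h2⟩ := exists_between hρ'
  exact exists_algorithm_of_isConnectedCost hT (isConnectedCost_PC n) h1 h1.le h2
    (fun _ _ => rfl) fun _ => rfl

theorem isAchievable_STRIP : IsAchievable STRIP (Real.sqrt 2) := by
  intro n T hT ρ' hρ'
  have hs : 1 ≤ Real.sqrt 2 := Real.one_le_sqrt.2 one_le_two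
  have hs0 : 0 < Real.sqrt 2 := by linarith
  obtain ⟨κ, h1, h2⟩ := exists_between ((one_lt_div hs0).2 hρ')
  rw [lt_div_iff₀' hs0] at h2
  exact exists_algorithm_of_isConnectedCost hT (isConnectedCost_STRIP n) h1 (by nlinarith) h2
    (fun _ _ => rfl) fun _ => rfl

theorem isAchievable_OBB : IsAchievable OBB (5 / 4) := by
  intro n T hT ρ' hρ'
  set δ := min (1 / 100) ((ρ' - 5 / 4) / 10) with hδ
  have h0 : 0 < δ := lt_min (by norm_num) (by linarith)
  have h1 : δ ≤ 1 / 100 := min_le_left _ _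
  have h2 : δ ≤ (ρ' - 5 / 4) / 10 := min_le_right _ _
  exact exists_algorithm_of_isConnectedCost hT (isConnectedCost_boxCost n h0 h1) (by linarith)
    (by nlinarith) (by nlinarith) (fun _ _ => rfl) fun P => (iInf_boxCost P).symm

/-! ### Lower bounds from barriers; principal components and covering strips -/

section Barrier

variable {D : ShapeDescriptor} {n : ℕ} {T : ℝ}

theorem approxRatio_le_worstRatio (A : StateAwareAlgorithm n T) (P : MovingPoints n T)
    (t : Icc (0 : ℝ) T) : approxRatio D (A.output P t) (P.pos t) ≤ worstRatio D A :=
  le_iSup₂ (f := fun (P : MovingPoints n T) t => approxRatio D (A.output P t) (P.pos t)) P t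

theorem iInf_le_of_nonneg (hD : ∀ γ P, 0 ≤ D n γ P) (P : Fin n → Plane) (γ : Orientation) :
    ⨅ γ, D n γ P ≤ D n γ P :=
  ciInf_le ⟨0, by rintro _ ⟨γ, rfl⟩; exact hD γ P⟩ γ

theorem one_le_approxRatio (hD : ∀ γ P, 0 ≤ D n γ P) (γ : Orientation) (P : Fin n → Plane) :
    1 ≤ approxRatio D γ P := by
  have hopt : 0 ≤ ⨅ γ, D n γ P := Real.iInf_nonneg fun γ => hD γ P
  have hle := iInf_le_of_nonneg hD P γ
  rcases (hD γ P).eq_or_lt with h | h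
  · rw [approxRatio, costRatio, if_pos ⟨by linarith, h.symm⟩]
  · rw [← ENNReal.ofReal_one]
    exact le_costRatio hopt h (by linarith)

theorem le_approxRatio (hD : ∀ γ P, 0 ≤ D n γ P) {γ γ' : Orientation} {P : Fin n → Plane} {ρ : ℝ}
    (hρ : 0 ≤ ρ) (hpos : 0 < D n γ P) (h : ρ * D n γ' P ≤ D n γ P) :
    ENNReal.ofReal ρ ≤ approxRatio D γ P :=
  le_costRatio (Real.iInf_nonneg fun γ => hD γ P) hpos
    ((mul_le_mul_of_nonneg_left (iInf_le_of_nonneg hD P γ') hρ).trans h)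

/-- If the optimal orientations at time `0` are on the positive side of `g`, those at time `T` are
on the negative side, both with cost `0`, and orientations on the zero set of `g` always cost at
least `ρ` times the minimum, then no continuous algorithm has a ratio below `ρ`: the output has to
cross the zero set. -/
theorem le_worstRatio_of_barrier (hD : ∀ γ P, 0 ≤ D n γ P) {A : StateAwareAlgorithm n T}
    (hA : A.IsContinuous) (P : MovingPoints n T) {ρ : ℝ} (hρ : 0 ≤ ρ) {t₀ t₁ : Icc (0 : ℝ) T}
    {g : ℝ → ℝ} (hg : Continuous g) (hper : Function.Periodic g Real.pi)
    (hz₀ : ∃ θ : ℝ, D n (θ : Orientation) (P.pos t₀) = 0)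
    (hz₁ : ∃ θ : ℝ, D n (θ : Orientation) (P.pos t₁) = 0)
    (h₀ : ∀ θ : ℝ, D n (θ : Orientation) (P.pos t₀) = 0 → 0 < g θ)
    (h₁ : ∀ θ : ℝ, D n (θ : Orientation) (P.pos t₁) = 0 → g θ < 0)
    (hbar : ∀ (t : Icc (0 : ℝ) T) (θ : ℝ), g θ = 0 → 0 < D n (θ : Orientation) (P.pos t) ∧
      ∃ θ' : ℝ, ρ * D n (θ' : Orientation) (P.pos t) ≤ D n (θ : Orientation) (P.pos t)) :
    ENNReal.ofReal ρ ≤ worstRatio D A := by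
  -- an output of positive cost where the minimum is `0` has infinite ratio
  have hzero : ∀ t, (∃ θ : ℝ, D n (θ : Orientation) (P.pos t) = 0) →
      D n (A.output P t) (P.pos t) ≠ 0 → ENNReal.ofReal ρ ≤ worstRatio D A := by
    rintro t ⟨θ, hθ⟩ hne
    refine le_trans ?_ (approxRatio_le_worstRatio A P t)
    exact le_approxRatio hD hρ ((hD _ _).lt_of_ne' hne) (γ' := θ)
      (by rw [hθ, mul_zero]; exact hD _ _)
  by_cases e₀ : D n (A.output P t₀) (P.pos t₀) = 0
  swap
  · exact hzero t₀ hz₀ e₀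
  by_cases e₁ : D n (A.output P t₁) (P.pos t₁) = 0
  swap
  · exact hzero t₁ hz₁ e₁
  have hlift : Continuous (hper.lift : Orientation → ℝ) :=
    QuotientAddGroup.isOpenQuotientMap_mk.continuous_comp_iff.1 hg
  have hcont : Continuous fun t => hper.lift (A.output P t) := hlift.comp (hA P)
  have : PreconnectedSpace (Icc (0 : ℝ) T) := Subtype.preconnectedSpace isPreconnected_Icc
  have hpos : 0 ≤ hper.lift (A.output P t₀) := by
    obtain ⟨θ, hθ⟩ := exists_coe_eq (A.output P t₀)
    rw [← hθ] at e₀ ⊢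
    exact (h₀ θ e₀).le
  have hneg : hper.lift (A.output P t₁) ≤ 0 := by
    obtain ⟨θ, hθ⟩ := exists_coe_eq (A.output P t₁)
    rw [← hθ] at e₁ ⊢
    exact (h₁ θ e₁).le
  obtain ⟨t, ht⟩ := mem_range_of_exists_le_of_exists_ge hcont ⟨t₁, hneg⟩ ⟨t₀, hpos⟩
  refine le_trans ?_ (approxRatio_le_worstRatio A P t)
  obtain ⟨θ, hθ⟩ := exists_coe_eq (A.output P t)
  simp only [← hθ] at ht ⊢
  obtain ⟨hcost, θ', hθ'⟩ := hbar t θ ht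
  exact le_approxRatio hD hρ hcost hθ'

end Barrier

theorem PC_nonneg {n : ℕ} (γ : Orientation) (P : Fin n → Plane) : 0 ≤ PC n γ P := by
  obtain ⟨θ, rfl⟩ := exists_coe_eq γ
  rw [PC_coe]
  exact Finset.sum_nonneg fun _ _ => sq_nonneg _

theorem STRIP_nonneg {n : ℕ} (γ : Orientation) (P : Fin n → Plane) : 0 ≤ STRIP n γ P := by
  obtain ⟨θ, rfl⟩ := exists_coe_eq γ
  exact extent_nonneg _ _

theorem OBB_nonneg {n : ℕ} (γ : Orientation) (P : Fin n → Plane) : 0 ≤ OBB n γ P := by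
  obtain ⟨θ, rfl⟩ := exists_coe_eq γ
  exact mul_nonneg (extent_nonneg _ _) (extent_nonneg _ _)

/-- A moving set of `n` points given by the coordinates of its points as functions of time. -/
def movingPoints (n : ℕ) (T : ℝ) (x y : ℝ → ℕ → ℝ) (hx : ∀ i, Continuous fun t => x t i)
    (hy : ∀ i, Continuous fun t => y t i)
    (hne : ∀ t ∈ Icc 0 T, ∃ i j : Fin n, x t i ≠ x t j ∨ y t i ≠ y t j) : MovingPoints n T where
  pos t i := !₂[x t i, y t i]
  continuous_pos i := by
    refine (PiLp.continuous_toLp 2 _).comp (continuous_pi fun k => ?_)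
    fin_cases k
    · exact (hx i).comp continuous_subtype_val
    · exact (hy i).comp continuous_subtype_val
  not_all_equal t := by
    obtain ⟨i, j, h⟩ := hne t t.2
    refine ⟨i, j, fun heq => ?_⟩
    rcases h with h | h
    · exact h (by simpa using congrArg (fun v : Plane => v 0) heq)
    · exact h (by simpa using congrArg (fun v : Plane => v 1) heq)

theorem abs_le_extent {n : ℕ} {x y : ℕ → ℝ} (i j : Fin n) (θ : ℝ) :
    |(x i - x j) * Real.cos θ + (y i - y j) * Real.sin θ| ≤
      extent (unitVec θ) (fun i : Fin n => !₂[x i, y i]) := by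
  have h := abs_inner_le_extent (unitVec θ) (fun i : Fin n => (!₂[x i, y i] : Plane)) i j
  rw [inner_unitVec] at h
  simpa using h

theorem extent_le_sub {n : ℕ} {x y : ℕ → ℝ} {θ lo hi : ℝ} (hle : lo ≤ hi)
    (h : ∀ i, x i * Real.cos θ + y i * Real.sin θ ∈ Icc lo hi) :
    extent (unitVec θ) (fun i : Fin n => (!₂[x i, y i] : Plane)) ≤ hi - lo := by
  refine extent_le (sub_nonneg.2 hle) fun i j => ?_
  rw [inner_sub_left, inner_unitVec, inner_unitVec]
  simp only [Matrix.cons_val_zero, Matrix.cons_val_one]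
  linarith [(h i).2, (h j).1]

theorem one_le_worstRatio_PC {n : ℕ} (hn : 2 ≤ n) {T : ℝ} (hT : 0 < T)
    (A : StateAwareAlgorithm n T) : 1 ≤ worstRatio PC A := by
  let P : MovingPoints n T := movingPoints n T (fun _ i => i) (fun _ _ => 0)
    (fun _ => continuous_const) (fun _ => continuous_const)
    fun _ _ => ⟨⟨0, by omega⟩, ⟨1, by omega⟩, Or.inl (by simp)⟩
  exact (one_le_approxRatio PC_nonneg _ _).trans (approxRatio_le_worstRatio A P ⟨0, le_rfl, hT.le⟩)

section Rectangle

/-- The abscissae of the corners of a rectangle with sides `a` and `b`. -/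
def rectX (a : ℝ) : ℕ → ℝ
  | 0 => 0
  | 1 => a
  | 2 => a
  | _ => 0

/-- The ordinates of the corners of a rectangle with sides `a` and `b`. -/
def rectY (b : ℝ) : ℕ → ℝ
  | 0 => 0
  | 1 => 0
  | 2 => b
  | _ => b

theorem rectX_mem {a : ℝ} (ha : 0 ≤ a) (i : ℕ) : rectX a i ∈ Icc 0 a := by
  match i with
  | 0 => exact ⟨le_rfl, ha⟩
  | 1 => exact ⟨ha, le_rfl⟩
  | 2 => exact ⟨ha, le_rfl⟩
  | _ + 3 => exact ⟨le_rfl, ha⟩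

theorem rectY_mem {b : ℝ} (hb : 0 ≤ b) (i : ℕ) : rectY b i ∈ Icc 0 b := by
  match i with
  | 0 => exact ⟨le_rfl, hb⟩
  | 1 => exact ⟨le_rfl, hb⟩
  | 2 => exact ⟨hb, le_rfl⟩
  | _ + 3 => exact ⟨hb, le_rfl⟩

theorem continuous_rectX (i : ℕ) : Continuous fun a => rectX a i := by
  match i with
  | 0 => exact continuous_const
  | 1 => exact continuous_id
  | 2 => exact continuous_id
  | _ + 3 => exact continuous_const

theorem continuous_rectY (i : ℕ) : Continuous fun b => rectY b i := by
  match i with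
  | 0 => exact continuous_const
  | 1 => exact continuous_const
  | 2 => exact continuous_id
  | _ + 3 => exact continuous_id

variable {n : ℕ}

theorem abs_mul_sin_add_abs_mul_cos_le_STRIP_rect (hn : 4 ≤ n) (a b θ : ℝ) :
    |a * Real.sin θ| + |b * Real.cos θ| ≤
      STRIP n (θ : Orientation) fun i : Fin n => !₂[rectX a i, rectY b i] := by
  have h1 := abs_le_extent (x := rectX a) (y := rectY b) (⟨2, by omega⟩ : Fin n)
    (⟨0, by omega⟩ : Fin n) (θ + Real.pi / 2)
  have h2 := abs_le_extent (x := rectX a) (y := rectY b) (⟨1, by omega⟩ : Fin n)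
    (⟨3, by omega⟩ : Fin n) (θ + Real.pi / 2)
  rw [STRIP_coe]
  generalize extent (unitVec (θ + Real.pi / 2)) _ = W at h1 h2 ⊢
  simp only [rectX, rectY, sub_zero, zero_sub, Real.cos_add_pi_div_two, Real.sin_add_pi_div_two,
    abs_le] at h1 h2
  rcases abs_cases (a * Real.sin θ) with ⟨h3, _⟩ | ⟨h3, _⟩ <;>
    rcases abs_cases (b * Real.cos θ) with ⟨h4, _⟩ | ⟨h4, _⟩ <;>
      rw [h3, h4] <;> linarith [h1.1, h1.2, h2.1, h2.2]

theorem STRIP_rect_zero_le {a b : ℝ} (hb : 0 ≤ b) :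
    STRIP n ((0 : ℝ) : Orientation) (fun i : Fin n => !₂[rectX a i, rectY b i]) ≤ b := by
  rw [STRIP_coe]
  refine (extent_le_sub hb fun i => ?_).trans (sub_zero b).le
  simpa using rectY_mem hb i

theorem STRIP_rect_pi_div_two_le {a b : ℝ} (ha : 0 ≤ a) :
    STRIP n ((Real.pi / 2 : ℝ) : Orientation) (fun i : Fin n => !₂[rectX a i, rectY b i]) ≤ a := by
  rw [STRIP_coe, add_halves]
  refine (extent_le_sub (neg_nonpos.2 ha) fun i => ?_).trans (by simp)
  have := rectX_mem ha i
  simpa using ⟨this.2, this.1⟩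

/-- A horizontal segment that becomes a vertical one through rectangles: an orientation at angle
`π / 4` to the sides always costs at least `√2` times the shorter side. -/
theorem sqrt_two_le_worstRatio_STRIP (hn : 4 ≤ n) {T : ℝ} (hT : 0 < T)
    {A : StateAwareAlgorithm n T} (hA : A.IsContinuous) :
    ENNReal.ofReal (Real.sqrt 2) ≤ worstRatio STRIP A := by
  let P : MovingPoints n T := movingPoints n T (fun t => rectX (1 - t / T)) (fun t => rectY (t / T))
    (fun i => (continuous_rectX i).comp (by fun_prop))
    (fun i => (continuous_rectY i).comp (by fun_prop))
    (by
      intro t _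
      refine ⟨⟨2, by omega⟩, ⟨0, by omega⟩, ?_⟩
      by_contra! h
      simp only [rectX, rectY] at h
      linarith [h.1, h.2])
  have hP : ∀ t : Icc (0 : ℝ) T, P.pos t =
      fun i : Fin n => !₂[rectX (1 - t / T) i, rectY (t / T) i] := fun t => rfl
  refine le_worstRatio_of_barrier STRIP_nonneg hA P (Real.sqrt_nonneg 2)
    (t₀ := ⟨0, le_rfl, hT.le⟩) (t₁ := ⟨T, hT.le, le_rfl⟩)
    (g := fun θ => Real.cos (2 * θ)) (by fun_prop) ?_ ⟨0, ?_⟩ ⟨Real.pi / 2, ?_⟩ ?_ ?_ ?_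
  · intro θ
    simp only [mul_add, Real.cos_add_two_pi]
  · rw [hP]
    exact le_antisymm (STRIP_rect_zero_le (by simp) |>.trans (by simp)) (STRIP_nonneg _ _)
  · rw [hP]
    refine le_antisymm (STRIP_rect_pi_div_two_le ?_ |>.trans ?_) (STRIP_nonneg _ _) <;>
      simp [div_self hT.ne']
  · intro θ hθ
    have h := abs_mul_sin_add_abs_mul_cos_le_STRIP_rect hn (1 - 0 / T) (0 / T) θ
    rw [hP] at hθ
    rw [hθ] at h
    simp only [zero_div, sub_zero, one_mul, zero_mul, abs_zero, add_zero] at h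
    have h0 := abs_nonpos_iff.1 h
    simp [Real.cos_two_mul', h0]
    nlinarith [Real.sin_sq_add_cos_sq θ]
  · intro θ hθ
    have h := abs_mul_sin_add_abs_mul_cos_le_STRIP_rect hn (1 - T / T) (T / T) θ
    rw [hP] at hθ
    rw [hθ] at h
    simp only [div_self hT.ne', sub_self, one_mul, zero_mul, abs_zero, zero_add] at h
    have h0 := abs_nonpos_iff.1 h
    simp [Real.cos_two_mul', h0]
    nlinarith [Real.sin_sq_add_cos_sq θ]
  · intro t θ hθ
    have hb : 0 ≤ (t : ℝ) / T := div_nonneg t.2.1 hT.le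
    have ha : 0 ≤ 1 - (t : ℝ) / T := sub_nonneg.2 ((div_le_one hT).2 t.2.2)
    have h := abs_mul_sin_add_abs_mul_cos_le_STRIP_rect hn (1 - (t : ℝ) / T) ((t : ℝ) / T) θ
    have h1 := STRIP_rect_zero_le (n := n) (a := 1 - (t : ℝ) / T) hb
    have h2 := STRIP_rect_pi_div_two_le (n := n) (b := (t : ℝ) / T) ha
    rw [← hP] at h h1 h2
    have hsc : Real.sin θ ^ 2 = 1 / 2 ∧ Real.cos θ ^ 2 = 1 / 2 := by
      simp only [Real.cos_two_mul'] at hθ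
      constructor <;> linarith [Real.sin_sq_add_cos_sq θ]
    have hs2 : Real.sqrt 2 * Real.sqrt 2 = 2 := Real.mul_self_sqrt zero_le_two
    have hs0 := Real.sqrt_nonneg 2
    have habs : ∀ r : ℝ, r ^ 2 = 1 / 2 → |r| = Real.sqrt 2 / 2 := fun r hr => by
      rw [← abs_of_nonneg (by positivity : 0 ≤ Real.sqrt 2 / 2), ← sq_eq_sq_iff_abs_eq_abs, hr]
      nlinarith
    rw [abs_mul, abs_mul, habs _ hsc.1, habs _ hsc.2, abs_of_nonneg ha, abs_of_nonneg hb] at h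
    have hs1 : 1 ≤ Real.sqrt 2 := Real.one_le_sqrt.2 one_le_two
    refine ⟨lt_of_lt_of_le ?_ h, ?_⟩
    · nlinarith
    · rcases le_total (1 - (t : ℝ) / T) ((t : ℝ) / T) with hle | hle
      · refine ⟨Real.pi / 2, le_trans ?_ h⟩
        nlinarith [mul_le_mul_of_nonneg_left h2 hs0, mul_le_mul_of_nonneg_left hle hs0]
      · refine ⟨0, le_trans ?_ h⟩
        nlinarith [mul_le_mul_of_nonneg_left h1 hs0, mul_le_mul_of_nonneg_left hle hs0]

end Rectangle

/-! ### Lower bound for bounding boxes -/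

section Rhombus

/-- The abscissae of the corners of a parallelogram: a rhombus with diagonals `2` and `1` for
`w = 0`, flattened to a segment of slope `1 / 2` for `w = 1` and of slope `-1 / 2` for `w = -1`. -/
def kiteX (w : ℝ) : ℕ → ℝ
  | 0 => 1 - |w| / 5
  | 1 => -(1 - |w| / 5)
  | 2 => w / 5
  | _ => -(w / 5)

/-- The ordinates of the corners whose abscissae are given by `kiteX`. -/
def kiteY (w : ℝ) : ℕ → ℝ
  | 0 => 2 * w / 5
  | 1 => -(2 * w / 5)
  | 2 => 1 / 2 - 2 * |w| / 5
  | _ => -(1 / 2 - 2 * |w| / 5)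

theorem continuous_kiteX (i : ℕ) : Continuous fun w => kiteX w i := by
  match i with
  | 0 => simp only [kiteX]; fun_prop
  | 1 => simp only [kiteX]; fun_prop
  | 2 => simp only [kiteX]; fun_prop
  | _ + 3 => simp only [kiteX]; fun_prop

theorem continuous_kiteY (i : ℕ) : Continuous fun w => kiteY w i := by
  match i with
  | 0 => simp only [kiteY]; fun_prop
  | 1 => simp only [kiteY]; fun_prop
  | 2 => simp only [kiteY]; fun_prop
  | _ + 3 => simp only [kiteY]; fun_prop

variable {n : ℕ}

theorem abs_kite_zero_le (hn : 4 ≤ n) (w θ : ℝ) :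
    2 * |(1 - |w| / 5) * Real.cos θ + 2 * w / 5 * Real.sin θ| ≤
      extent (unitVec θ) fun i : Fin n => !₂[kiteX w i, kiteY w i] := by
  refine le_trans (le_of_eq ?_) (abs_le_extent (x := kiteX w) (y := kiteY w)
    (⟨0, by omega⟩ : Fin n) (⟨1, by omega⟩ : Fin n) θ)
  simp only [kiteX, kiteY]
  rw [← abs_two, ← abs_mul, abs_two]
  congr 1
  ring

theorem abs_kite_two_le (hn : 4 ≤ n) (w θ : ℝ) :
    2 * |w / 5 * Real.cos θ + (1 / 2 - 2 * |w| / 5) * Real.sin θ| ≤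
      extent (unitVec θ) fun i : Fin n => !₂[kiteX w i, kiteY w i] := by
  refine le_trans (le_of_eq ?_) (abs_le_extent (x := kiteX w) (y := kiteY w)
    (⟨2, by omega⟩ : Fin n) (⟨3, by omega⟩ : Fin n) θ)
  simp only [kiteX, kiteY]
  rw [← abs_two, ← abs_mul, abs_two]
  congr 1
  ring

theorem extent_kite_le {w θ h : ℝ}
    (h0 : |(1 - |w| / 5) * Real.cos θ + 2 * w / 5 * Real.sin θ| ≤ h)
    (h2 : |w / 5 * Real.cos θ + (1 / 2 - 2 * |w| / 5) * Real.sin θ| ≤ h) :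
    extent (unitVec θ) (fun i : Fin n => !₂[kiteX w i, kiteY w i]) ≤ 2 * h := by
  have hh : 0 ≤ h := (abs_nonneg _).trans h0
  rw [abs_le] at h0 h2
  refine (extent_le_sub (lo := -h) (hi := h) (by linarith) fun i => ?_).trans (by linarith)
  match i with
  | 0 => exact ⟨h0.1, h0.2⟩
  | 1 => simp only [kiteX, kiteY]; constructor <;> linarith [h0.1, h0.2]
  | 2 => exact ⟨h2.1, h2.2⟩
  | _ + 3 => simp only [kiteX, kiteY]; constructor <;> linarith [h2.1, h2.2]

/-- The angle of the direction `(2, 1)`. -/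
def sideAngle : ℝ := Real.arctan (1 / 2)

theorem two_mul_sin_sideAngle : 2 * Real.sin sideAngle = Real.cos sideAngle := by
  rw [sideAngle, Real.sin_arctan, Real.cos_arctan]
  ring

theorem cos_sq_sideAngle : Real.cos sideAngle ^ 2 = 4 / 5 := by
  rw [sideAngle, Real.cos_sq_arctan]
  norm_num

theorem cos_sideAngle_pos : 0 < Real.cos sideAngle := Real.cos_arctan_pos _

/-- The bounding box along the sides `±(2, 1)` of the rhombus. -/
theorem exists_OBB_kite_le {w : ℝ} (hw : |w| ≤ 1) :
    ∃ θ : ℝ, OBB n (θ : Orientation) (fun i : Fin n => !₂[kiteX w i, kiteY w i]) ≤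
      8 / 5 * (1 - |w|) := by
  have hs := two_mul_sin_sideAngle
  have hc := cos_sq_sideAngle
  have hc0 := cos_sideAngle_pos
  have hmul : 2 * Real.cos sideAngle * (2 * ((1 - |w|) * Real.sin sideAngle)) =
      2 * (1 - |w|) * Real.cos sideAngle ^ 2 := by
    linear_combination 2 * (1 - |w|) * Real.cos sideAngle * hs
  have hfin : ∀ a b : ℝ, 0 ≤ a → 0 ≤ b → a ≤ 2 * Real.cos sideAngle →
      b ≤ 2 * ((1 - |w|) * Real.sin sideAngle) → a * b ≤ 8 / 5 * (1 - |w|) := by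
    intro a b _ hb h1 h2
    refine (mul_le_mul h1 h2 hb (by linarith)).trans ?_
    rw [hmul, hc]
    linarith
  have hsv : Real.sin sideAngle = Real.cos sideAngle / 2 := by linarith
  have h0 := abs_nonneg w
  rcases le_total 0 w with hw0 | hw0
  · rw [abs_of_nonneg hw0] at hfin hw
    rw [abs_of_nonneg hw0]
    refine ⟨sideAngle, hfin _ _ (extent_nonneg _ _) (extent_nonneg _ _) (extent_kite_le ?_ ?_)
      (extent_kite_le ?_ ?_)⟩ <;>
    simp only [Real.cos_add_pi_div_two, Real.sin_add_pi_div_two, hsv, abs_of_nonneg hw0, abs_le] <;>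
    constructor <;> nlinarith
  · rw [abs_of_nonpos hw0] at hfin hw
    rw [abs_of_nonpos hw0]
    refine ⟨-sideAngle, hfin _ _ (extent_nonneg _ _) (extent_nonneg _ _) (extent_kite_le ?_ ?_)
      (extent_kite_le ?_ ?_)⟩ <;>
    simp only [Real.cos_add_pi_div_two, Real.sin_add_pi_div_two, Real.cos_neg, Real.sin_neg, hsv,
      abs_of_nonpos hw0, abs_le] <;>
    constructor <;> nlinarith

theorem sin_four_mul (θ : ℝ) :
    Real.sin (4 * θ) =
      4 * (Real.sin θ * Real.cos θ) * (Real.cos θ ^ 2 - Real.sin θ ^ 2) := by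
  rw [show 4 * θ = 2 * (2 * θ) by ring, Real.sin_two_mul, Real.sin_two_mul, Real.cos_two_mul']
  ring

/-- The bounding boxes along the diagonals of the rhombus and at angle `π / 4` to them. -/
theorem le_OBB_kite_of_sin_four_mul_eq_zero (hn : 4 ≤ n) {w θ : ℝ} (hw : |w| ≤ 1)
    (hθ : Real.sin (4 * θ) = 0) :
    0 < OBB n (θ : Orientation) (fun i : Fin n => !₂[kiteX w i, kiteY w i]) ∧
      2 * (1 - |w|) ≤ OBB n (θ : Orientation) (fun i : Fin n => !₂[kiteX w i, kiteY w i]) := by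
  have h0 := abs_nonneg w
  have hle : ∀ a b c d : ℝ, 2 * |a| ≤ c → 2 * |b| ≤ d → 4 * |a * b| ≤ c * d := by
    intro a b c d h1 h2
    rw [abs_mul]
    have := mul_le_mul h1 h2 (by positivity) ((by positivity : 0 ≤ 2 * |a|).trans h1)
    linarith
  have hsq := Real.sin_sq_add_cos_sq θ
  have k0 := abs_kite_zero_le hn w θ
  have k0' := abs_kite_zero_le hn w (θ + Real.pi / 2)
  have k2 := abs_kite_two_le hn w θ
  have k2' := abs_kite_two_le hn w (θ + Real.pi / 2)
  rw [Real.cos_add_pi_div_two, Real.sin_add_pi_div_two] at k0' k2'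
  rw [OBB_coe]
  have hbox : 0 < (1 - |w| / 5) * (1 / 2 - 2 * |w| / 5) := by
    apply mul_pos <;> linarith
  rw [sin_four_mul] at hθ
  rcases mul_eq_zero.1 hθ with h | h
  · rcases mul_eq_zero.1 (mul_eq_zero.1 h |>.resolve_left (by norm_num)) with h | h
    · have hc : Real.cos θ ^ 2 = 1 := by rw [h] at hsq; linarith
      have := hle _ _ _ _ k0 k2'
      rw [h] at this
      have e : ((1 - |w| / 5) * Real.cos θ + 2 * w / 5 * 0) *
          (w / 5 * -0 + (1 / 2 - 2 * |w| / 5) * Real.cos θ) =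
          (1 - |w| / 5) * (1 / 2 - 2 * |w| / 5) := by
        linear_combination (1 - |w| / 5) * (1 / 2 - 2 * |w| / 5) * hc
      rw [e, abs_of_pos hbox] at this
      constructor <;> nlinarith
    · have hs : Real.sin θ ^ 2 = 1 := by rw [h] at hsq; linarith
      have := hle _ _ _ _ k2 k0'
      rw [h] at this
      have e : (w / 5 * 0 + (1 / 2 - 2 * |w| / 5) * Real.sin θ) *
          ((1 - |w| / 5) * -Real.sin θ + 2 * w / 5 * 0) =
          -((1 - |w| / 5) * (1 / 2 - 2 * |w| / 5)) := by
        linear_combination -(1 - |w| / 5) * (1 / 2 - 2 * |w| / 5) * hs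
      rw [e, abs_neg, abs_of_pos hbox] at this
      constructor <;> nlinarith
  · have := hle _ _ _ _ k0 k0'
    have hww : w ^ 2 = |w| ^ 2 := (sq_abs w).symm
    have e : ((1 - |w| / 5) * Real.cos θ + 2 * w / 5 * Real.sin θ) *
        ((1 - |w| / 5) * -Real.sin θ + 2 * w / 5 * Real.cos θ) =
        ((2 * |w| / 5) ^ 2 - (1 - |w| / 5) ^ 2) * (Real.sin θ * Real.cos θ) := by
      linear_combination ((1 - |w| / 5) * (2 * w / 5)) * h +
        4 / 25 * (Real.sin θ * Real.cos θ) * hww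
    have hsc : |Real.sin θ * Real.cos θ| = 1 / 2 := by
      rw [← abs_of_pos (by norm_num : (0 : ℝ) < 1 / 2), ← sq_eq_sq_iff_abs_eq_abs, mul_pow]
      have h1 : Real.sin θ ^ 2 = 1 / 2 := by linarith
      have h2 : Real.cos θ ^ 2 = 1 / 2 := by linarith
      rw [h1, h2]
      norm_num
    have hneg : (2 * |w| / 5) ^ 2 - (1 - |w| / 5) ^ 2 < 0 := by nlinarith
    rw [e, abs_mul, hsc, abs_of_neg hneg] at this
    constructor <;> nlinarith

theorem sin_four_mul_pos_of_OBB_kite (hn : 4 ≤ n) {θ : ℝ}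
    (h : OBB n (θ : Orientation) (fun i : Fin n => !₂[kiteX 1 i, kiteY 1 i]) = 0) :
    0 < Real.sin (4 * θ) := by
  have k0 := abs_kite_zero_le hn 1 θ
  have k0' := abs_kite_zero_le hn 1 (θ + Real.pi / 2)
  rw [Real.cos_add_pi_div_two, Real.sin_add_pi_div_two] at k0'
  have hsq := Real.sin_sq_add_cos_sq θ
  rw [sin_four_mul]
  rw [OBB_coe] at h
  rcases mul_eq_zero.1 h with h | h
  · rw [h] at k0
    have h1 := abs_nonpos_iff.1 (by linarith :
      |(1 - |(1 : ℝ)| / 5) * Real.cos θ + 2 * 1 / 5 * Real.sin θ| ≤ 0)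
    rw [abs_one] at h1
    have h2 : Real.sin θ = -2 * Real.cos θ := by linarith
    rw [h2] at hsq ⊢
    nlinarith
  · rw [h] at k0'
    have h1 := abs_nonpos_iff.1 (by linarith :
      |(1 - |(1 : ℝ)| / 5) * -Real.sin θ + 2 * 1 / 5 * Real.cos θ| ≤ 0)
    rw [abs_one] at h1
    have h2 : Real.cos θ = 2 * Real.sin θ := by linarith
    rw [h2] at hsq ⊢
    nlinarith

theorem sin_four_mul_neg_of_OBB_kite (hn : 4 ≤ n) {θ : ℝ}
    (h : OBB n (θ : Orientation) (fun i : Fin n => !₂[kiteX (-1) i, kiteY (-1) i]) = 0) :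
    Real.sin (4 * θ) < 0 := by
  have k0 := abs_kite_zero_le hn (-1) θ
  have k0' := abs_kite_zero_le hn (-1) (θ + Real.pi / 2)
  rw [Real.cos_add_pi_div_two, Real.sin_add_pi_div_two] at k0'
  have hsq := Real.sin_sq_add_cos_sq θ
  rw [sin_four_mul]
  rw [OBB_coe] at h
  rcases mul_eq_zero.1 h with h | h
  · rw [h] at k0
    have h1 := abs_nonpos_iff.1 (by linarith :
      |(1 - |(-1 : ℝ)| / 5) * Real.cos θ + 2 * (-1) / 5 * Real.sin θ| ≤ 0)
    rw [abs_neg, abs_one] at h1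
    have h2 : Real.sin θ = 2 * Real.cos θ := by linarith
    rw [h2] at hsq ⊢
    nlinarith
  · rw [h] at k0'
    have h1 := abs_nonpos_iff.1 (by linarith :
      |(1 - |(-1 : ℝ)| / 5) * -Real.sin θ + 2 * (-1) / 5 * Real.cos θ| ≤ 0)
    rw [abs_neg, abs_one] at h1
    have h2 : Real.cos θ = -2 * Real.sin θ := by linarith
    rw [h2] at hsq ⊢
    nlinarith

/-- The rhombus with diagonals `2` and `1`, whose minimal bounding boxes lie along its two pairs of
sides, is flattened to a segment along one pair of sides in the past and along the other pair in the
future. -/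
theorem five_fourths_le_worstRatio_OBB (hn : 4 ≤ n) {T : ℝ} (hT : 0 < T)
    {A : StateAwareAlgorithm n T} (hA : A.IsContinuous) :
    ENNReal.ofReal (5 / 4) ≤ worstRatio OBB A := by
  have hw : ∀ t ∈ Icc 0 T, |1 - 2 * (t / T)| ≤ 1 := fun t ht => by
    have h0 : 0 ≤ t / T := div_nonneg ht.1 hT.le
    have h1 : t / T ≤ 1 := (div_le_one hT).2 ht.2
    rw [abs_le]
    constructor <;> linarith
  let P : MovingPoints n T := movingPoints n T (fun t => kiteX (1 - 2 * (t / T)))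
    (fun t => kiteY (1 - 2 * (t / T))) (fun i => (continuous_kiteX i).comp (by fun_prop))
    (fun i => (continuous_kiteY i).comp (by fun_prop))
    (by
      intro t ht
      refine ⟨⟨0, by omega⟩, ⟨1, by omega⟩, Or.inl ?_⟩
      have := hw t ht
      simp only [kiteX]
      intro h
      linarith)
  have hP : ∀ t : Icc (0 : ℝ) T, P.pos t = fun i : Fin n =>
      !₂[kiteX (1 - 2 * (t / T)) i, kiteY (1 - 2 * (t / T)) i] := fun t => rfl
  have e0 : 1 - 2 * (0 / T) = 1 := by simp
  have e1 : 1 - 2 * (T / T) = -1 := by rw [div_self hT.ne']; norm_num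
  have hz : ∀ w : ℝ, |w| = 1 → ∃ θ : ℝ,
      OBB n (θ : Orientation) (fun i : Fin n => !₂[kiteX w i, kiteY w i]) = 0 := fun w hw => by
    obtain ⟨θ, hθ⟩ := exists_OBB_kite_le (n := n) hw.le
    exact ⟨θ, le_antisymm (hθ.trans (by rw [hw]; norm_num)) (OBB_nonneg _ _)⟩
  refine le_worstRatio_of_barrier OBB_nonneg hA P (by norm_num)
    (t₀ := ⟨0, le_rfl, hT.le⟩) (t₁ := ⟨T, hT.le, le_rfl⟩)
    (g := fun θ => Real.sin (4 * θ)) (by fun_prop) ?_ ?_ ?_ ?_ ?_ ?_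
  · intro θ
    simp only
    rw [show 4 * (θ + Real.pi) = 4 * θ + 2 * Real.pi + 2 * Real.pi by ring, Real.sin_add_two_pi,
      Real.sin_add_two_pi]
  · rw [hP]
    simp only [e0]
    exact hz 1 abs_one
  · rw [hP]
    simp only [e1]
    exact hz (-1) (by simp)
  · intro θ hθ
    rw [hP] at hθ
    simp only [e0] at hθ
    exact sin_four_mul_pos_of_OBB_kite hn hθ
  · intro θ hθ
    rw [hP] at hθ
    simp only [e1] at hθ
    exact sin_four_mul_neg_of_OBB_kite hn hθ
  · intro t θ hθ
    rw [hP]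
    obtain ⟨hpos, hle⟩ := le_OBB_kite_of_sin_four_mul_eq_zero hn (hw t t.2) hθ
    obtain ⟨θ', hθ'⟩ := exists_OBB_kite_le (n := n) (hw t t.2)
    exact ⟨hpos, θ', by linarith⟩

end Rhombus

theorem topStabilityRatio_eq {D : ShapeDescriptor} {T ρ : ℝ} (hT : 0 < T) (h : IsAchievable D ρ)
    {n : ℕ} (hlow : ∀ A : StateAwareAlgorithm n T, A.IsContinuous →
      ENNReal.ofReal ρ ≤ worstRatio D A) : topStabilityRatio D T = ENNReal.ofReal ρ :=
  le_antisymm (h.topStabilityRatio_le hT) (le_iInf₂ fun A hA =>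
    (hlow (A n) (hA n)).trans (le_iSup (fun n => worstRatio D (A n)) n))

theorem topStabilityRatioOf_eq {D : ShapeDescriptor} {T ρ : ℝ} (hT : 0 < T) (h : IsAchievable D ρ)
    {n : ℕ} (hlow : ∀ A : StateAwareAlgorithm n T, A.IsContinuous →
      ENNReal.ofReal ρ ≤ worstRatio D A) : topStabilityRatioOf D n T = ENNReal.ofReal ρ :=
  le_antisymm (h.topStabilityRatioOf_le hT n) (le_iInf₂ hlow)

end ShapeStability

end

theorem theorem2 (T : ℝ) (hT : 0 < T) :
    (ShapeStability.topStabilityRatio ShapeStability.PC T = 1 ∧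
      ShapeStability.topStabilityRatio ShapeStability.OBB T = 5 / 4 ∧
      ShapeStability.topStabilityRatio ShapeStability.STRIP T = ENNReal.ofReal (Real.sqrt 2)) ∧
    (∀ n : ℕ, 2 ≤ n → ShapeStability.topStabilityRatioOf ShapeStability.PC n T = 1) ∧
    (∀ n : ℕ, 5 ≤ n → ShapeStability.topStabilityRatioOf ShapeStability.OBB n T = 5 / 4) ∧
    (∀ n : ℕ, 4 ≤ n → ShapeStability.topStabilityRatioOf ShapeStability.STRIP n T =
      ENNReal.ofReal (Real.sqrt 2)) := by
  have e1 : ENNReal.ofReal 1 = 1 := ENNReal.ofReal_one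
  have e2 : ENNReal.ofReal (5 / 4) = 5 / 4 := by
    rw [ENNReal.ofReal_div_of_pos (by norm_num)]
    norm_num
  have hPC : ∀ n : ℕ, 2 ≤ n → ∀ A : ShapeStability.StateAwareAlgorithm n T, A.IsContinuous →
      ENNReal.ofReal 1 ≤ ShapeStability.worstRatio ShapeStability.PC A := fun n hn A _ => by
    rw [e1]
    exact ShapeStability.one_le_worstRatio_PC hn hT A
  refine ⟨⟨?_, ?_, ?_⟩, fun n hn => ?_, fun n hn => ?_, fun n hn => ?_⟩
  · rw [← e1]
    exact ShapeStability.topStabilityRatio_eq hT ShapeStability.isAchievable_PC (hPC 2 le_rfl)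
  · rw [← e2]
    exact ShapeStability.topStabilityRatio_eq hT ShapeStability.isAchievable_OBB
      fun A hA => ShapeStability.five_fourths_le_worstRatio_OBB (n := 4) le_rfl hT hA
  · exact ShapeStability.topStabilityRatio_eq hT ShapeStability.isAchievable_STRIP
      fun A hA => ShapeStability.sqrt_two_le_worstRatio_STRIP (n := 4) le_rfl hT hA
  · rw [← e1]
    exact ShapeStability.topStabilityRatioOf_eq hT ShapeStability.isAchievable_PC (hPC n hn)
  · rw [← e2]
    exact ShapeStability.topStabilityRatioOf_eq hT ShapeStability.isAchievable_OBB
      fun A hA => ShapeStability.five_fourths_le_worstRatio_OBB (by omega) hT hA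
  · exact ShapeStability.topStabilityRatioOf_eq hT ShapeStability.isAchievable_STRIP
      fun A hA => ShapeStability.sqrt_two_le_worstRatio_STRIP hn hT hA
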